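/- **Direct part.** Let $U\subset\mathbb{R}^n$ be open and simply connected, with coordinates $u_1,\dots,u_n$, and let $\beta_{ij}$, $1\le i\neq j\le n$, be smooth real functions on $U$ satisfying the Lamé equations $$\frac{\partial\beta_{ij}}{\partial u_k}=\beta_{ik}\beta_{kj}\quad(i,j,k\ \text{distinct}),\qquad \frac{\partial\beta_{ij}}{\partial u_i}+\frac{\partial\beta_{ji}}{\partial u_j}+\sum_{k\neq i,j}\beta_{ki}\beta_{kj}=0\quad(i\ne j).\tag{1}$$ Consider the linear systems $$\frac{\partial H_j}{\partial u_i}=\beta_{ij}H_i\quad(i\ne j),\tag{2}$$ $$\frac{\partial X_i}{\partial u_j}=\beta_{ij}X_j\quad(i\neq j),\qquad \frac{\partial X_i}{\partial u_i}=-\sum_{k\neq i}\beta_{ki}X_k\tag{3}$$ for real functions $H_1,\dots,H_n$ and maps $X_1,\dots,X_n:U\to\mathbb{R}^n$. By virtue of (1), the integrability conditions of (2) and (3), that is, the equality of the mixed second derivatives computed formally from the equations, are satisfied. Let $H^\alpha=(H^\alpha_1,\dots,H^\alpha_n)$, $1\le\alpha\le m$, be arbitrary smooth solutions of (2), and let $X=(X_1,\dots,X_n)$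 be a smooth solution of (3) with $X^tX=I$ at some point of $U$; let $X_{ik}$ be the $i$-th component of $X_k$. Then there exist smooth maps $s^\alpha=(s^\alpha_1,\dots,s^\alpha_n):U\to\mathbb{R}^n$, $1\le\alpha\le m$, with $$ds^\alpha_i=\sum_{k=1}^nX_{ik}H^\alpha_k\,du_k,$$ and, for any such maps, writing $\mathcal G=(s^1,\dots,s^m)$ for the $n\times m$ matrix with columns $s^\alpha$, there exists a smooth map $\Omega:U\to M_{m\times m}(\mathbb{R})$ with $$d\Omega=\mathcal G^t\,d\mathcal G,\qquad \Omega+\Omega^t=\mathcal G^t\mathcal G+I_m .$$ For any such $\Omega$, the matrix $\Omega$ is invertible everywhere on $U$, the $(n+m)\times m$ matrix $$W=\begin{pmatrix}\mathcal G\,\Omega^{-1}\\ I_m-\Omega^{-1}\end{pmatrix}$$ satisfies $W^tW=I_m$, and each column of $W$ is a smooth map of $U$ into the unit sphere $\mathbb{S}^{n+m-1}\subset\mathbb{R}^{n+m}$ which, on the open set of its regular points (where its differential is injective), is an immersion into $\mathbb{S}^{n+m-1}$ with flat normal bundle for which $u_1,\dots,u_n$ are principal coordinates, i.e. the coordinate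 vector fields are pairwise orthogonal and $\alpha(\partial/\partial u_i,\partial/\partial u_j)=0$ for $i\ne j$, where $\alpha$ is the second fundamental form in the sphere. **Converse.** Let $f:M^n\to\mathbb{S}^{n+m-1}$ be a smooth immersion of a smooth $n$-manifold with flat normal bundle, let $p\in M$, and let $(u_1,\dots,u_n)$ be principal coordinates of $f$ on a neighbourhood of $p$. Then $f$ is obtained in this way near $p$: for each $1\le\alpha\le m$ there are an open simply connected neighbourhood $U$ of the coordinates of $p$, contained in the image of the coordinate chart, data $\beta_{ij},H^1,\dots,H^m,X,s^1,\dots,s^m,\Omega$ on $U$ as in the direct part, and a linear isometry $T$ of $\mathbb{R}^{n+m}$, such that $T\circ f$, in the coordinates $u_1,\dots,u_n$, is the $\alpha$-th column of $W$ on $U$. If $f(p)$ is different from the $(n+\alpha)$-th vector of the canonical basis of $\mathbb{R}^{n+m}$, one can take $T$ to be the identity. -/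

import Mathlib

open scoped Manifold ContDiff Matrix

namespace Ferapontov

/-- The Euclidean space `ℝⁿ`. -/
abbrev Eu (n : ℕ) : Type := EuclideanSpace ℝ (Fin n)

/-- The Euclidean space `ℝⁿ⁺ᵐ`, written as `ℝⁿ ⊕ ℝᵐ`. -/
abbrev Amb (n m : ℕ) : Type := EuclideanSpace ℝ (Fin n ⊕ Fin m)

/-- The partial derivative `∂f/∂u_k` of a map defined on (part of) `ℝⁿ`. -/
noncomputable def pd {n : ℕ} {F : Type*} [NormedAddCommGroup F] [NormedSpace ℝ F]
    (k : Fin n) (f : Eu n → F) (u : Eu n) : F :=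
  fderiv ℝ f u (EuclideanSpace.single k 1)

/-! ### Submanifolds of the unit sphere, in local coordinates -/

section Submanifold

variable {n : ℕ} {F : Type*} [NormedAddCommGroup F] [InnerProductSpace ℝ F]

/-- The normal space at `u` of `g` as an immersion into the unit sphere: the vectors orthogonal to
the position vector `g u` and to the tangent space of `g` at `u`. -/
noncomputable def normalSpace (g : Eu n → F) (u : Eu n) : Submodule ℝ F :=
  (Submodule.span ℝ {g u} ⊔ (fderiv ℝ g u).range)ᗮ

/-- The orthogonal projection onto the normal space. -/
noncomputable def normalProj [FiniteDimensional ℝ F] (g : Eu n → F) (u : Eu n) (v : F) : F :=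
  (normalSpace g u).starProjection v

/-- The normal connection: the covariant derivative of a normal field `ξ` along `∂/∂u_k`. -/
noncomputable def normalD [FiniteDimensional ℝ F] (g : Eu n → F) (k : Fin n) (ξ : Eu n → F)
    (u : Eu n) : F :=
  normalProj g u (pd k ξ u)

/-- The value `α(∂/∂u_i, ∂/∂u_j)` of the second fundamental form of `g` as an immersion into the
unit sphere. -/
noncomputable def secondForm [FiniteDimensional ℝ F] (g : Eu n → F) (i j : Fin n) (u : Eu n) : F :=
  normalProj g u (pd i (pd j g) u)

/-- The normal bundle of `g` (as an immersion of `V` into the unit sphere) is flat: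
the curvature `R(∂/∂u_j, ∂/∂u_k) ξ` of the normal connection vanishes for all local
smooth normal fields `ξ`. -/
def HasFlatNormalBundle [FiniteDimensional ℝ F] (g : Eu n → F) (V : Set (Eu n)) : Prop :=
  ∀ O : Set (Eu n), IsOpen O → O ⊆ V → ∀ ξ : Eu n → F, ContDiffOn ℝ ∞ ξ O →
    (∀ u ∈ O, ξ u ∈ normalSpace g u) →
    ∀ j k : Fin n, ∀ u ∈ O, normalD g j (normalD g k ξ) u = normalD g k (normalD g j ξ) u

/-- The standard coordinates `u_1, …, u_n` of `V` are principal coordinates of `g`, as an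
immersion into the unit sphere: the coordinate vector fields are pairwise orthogonal and
diagonalize the second fundamental form. -/
def HasPrincipalCoordinates [FiniteDimensional ℝ F] (g : Eu n → F) (V : Set (Eu n)) : Prop :=
  ∀ u ∈ V, ∀ i j : Fin n, i ≠ j → inner ℝ (pd i g u) (pd j g u) = 0 ∧ secondForm g i j u = 0

/-- The regular points in `U` of a map `g`. -/
def regularSet (g : Eu n → F) (U : Set (Eu n)) : Set (Eu n) :=
  {u ∈ U | Function.Injective (fderiv ℝ g u)}

/-- `g` is a smooth immersion of the open set `V` into the unit sphere. -/
structure IsSphericalImmersion (g : Eu n → F) (V : Set (Eu n)) : Prop where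
  isOpen : IsOpen V
  smooth : ContDiffOn ℝ ∞ g V
  mem_sphere : ∀ u ∈ V, g u ∈ Metric.sphere (0 : F) 1
  injective : ∀ u ∈ V, Function.Injective (fderiv ℝ g u)

end Submanifold

/-! ### The systems of partial differential equations -/

section Systems

variable {n m : ℕ}

/-- The Lamé equations for the rotation coefficients `β i j`, `i ≠ j`; the diagonal entries `β i i`
play no role. -/
structure IsRotation (U : Set (Eu n)) (β : Fin n → Fin n → Eu n → ℝ) : Prop where
  smooth : ∀ i j, i ≠ j → ContDiffOn ℝ ∞ (β i j) U
  eq_triple : ∀ i j k, i ≠ j → j ≠ k → k ≠ i → ∀ u ∈ U, pd k (β i j) u = β i k u * β k j u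
  eq_pair : ∀ i j, i ≠ j → ∀ u ∈ U, pd i (β i j) u + pd j (β j i) u +
    ∑ k ∈ Finset.univ.filter (fun k => k ≠ i ∧ k ≠ j), β k i u * β k j u = 0

/-- Smooth solutions `H = (H_1, …, H_n)` of the linear system `∂H_j/∂u_i = β_ij H_i`, `i ≠ j`. -/
structure IsLameFamily (U : Set (Eu n)) (β : Fin n → Fin n → Eu n → ℝ) (H : Fin n → Eu n → ℝ) :
    Prop where
  smooth : ∀ i, ContDiffOn ℝ ∞ (H i) U
  eq : ∀ i j, i ≠ j → ∀ u ∈ U, pd i (H j) u = β i j u * H i u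

/-- The matrix `X = (X_1, …, X_n)` with columns `X_k`. -/
def frameMatrix (X : Fin n → Eu n → Eu n) (u : Eu n) : Matrix (Fin n) (Fin n) ℝ :=
  Matrix.of fun i k => X k u i

/-- Smooth solutions `X_1, …, X_n` of `∂X_i/∂u_j = β_ij X_j`, `i ≠ j`, and
`∂X_i/∂u_i = -∑_{k ≠ i} β_ki X_k`, with `Xᵗ X = I` at some point of `U`. -/
structure IsLameFrame (U : Set (Eu n)) (β : Fin n → Fin n → Eu n → ℝ) (X : Fin n → Eu n → Eu n) :
    Prop where
  smooth : ∀ i, ContDiffOn ℝ ∞ (X i) U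
  eq_ne : ∀ i j, i ≠ j → ∀ u ∈ U, pd j (X i) u = β i j u • X j u
  eq_self : ∀ i, ∀ u ∈ U,
    pd i (X i) u = -∑ k ∈ Finset.univ.filter (fun k => k ≠ i), β k i u • X k u
  orthonormal : ∃ u ∈ U, (frameMatrix X u)ᵀ * frameMatrix X u = 1

/-- The coefficients of the system for the frame written as `∂X_i/∂u_j = ∑_l c_j(i,l) X_l`. -/
noncomputable def frameCoeff (β : Fin n → Fin n → Eu n → ℝ) (j i l : Fin n) (u : Eu n) : ℝ :=
  if i = j then (if l = i then 0 else -β l i u) else (if l = j then β i j u else 0)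

/-- The integrability conditions of the system for `H`: for `i, j, k` distinct, the expressions
for `∂²H_j/∂u_k∂u_i` and `∂²H_j/∂u_i∂u_k` obtained by differentiating the equations and substituting
them again coincide, for arbitrary values `h` of `H`. -/
def LameIntegrable (U : Set (Eu n)) (β : Fin n → Fin n → Eu n → ℝ) : Prop :=
  ∀ i j k, i ≠ j → j ≠ k → k ≠ i → ∀ u ∈ U, ∀ h : Fin n → ℝ,
    pd k (β i j) u * h i + β i j u * (β k i u * h k) =
      pd i (β k j) u * h k + β k j u * (β i k u * h i)

/-- The integrability conditions of the system for the frame: the expressions for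
`∂²X_i/∂u_k∂u_j` and `∂²X_i/∂u_j∂u_k` obtained by differentiating the equations and
substituting them again have the same coefficient at each `X_l`. -/
def FrameIntegrable (U : Set (Eu n)) (β : Fin n → Fin n → Eu n → ℝ) : Prop :=
  ∀ i j k l, ∀ u ∈ U,
    pd k (frameCoeff β j i l) u + ∑ p, frameCoeff β j i p u * frameCoeff β k p l u =
      pd j (frameCoeff β k i l) u + ∑ p, frameCoeff β k i p u * frameCoeff β j p l u

/-- `s : U → ℝⁿ` is smooth with `ds_i = ∑_k X_ik H_k du_k`. -/
structure IsPotential (U : Set (Eu n)) (X : Fin n → Eu n → Eu n) (H : Fin n → Eu n → ℝ)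
    (s : Eu n → Eu n) : Prop where
  smooth : ContDiffOn ℝ ∞ s U
  eq : ∀ i k, ∀ u ∈ U, pd k (fun v => s v i) u = frameMatrix X u i k * H k u

/-- The `n × m` matrix `𝒢 = (s^1, …, s^m)`. -/
def matG (s : Fin m → Eu n → Eu n) (u : Eu n) : Matrix (Fin n) (Fin m) ℝ :=
  Matrix.of fun i a => s a u i

/-- The entrywise partial derivative of a matrix-valued map. -/
noncomputable def pdMat {ι κ : Type*} (k : Fin n) (A : Eu n → Matrix ι κ ℝ) (u : Eu n) :
    Matrix ι κ ℝ :=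
  Matrix.of fun a b => pd k (fun v => A v a b) u

/-- `Ω` is smooth, `dΩ = 𝒢ᵗ d𝒢` and `Ω + Ωᵗ = 𝒢ᵗ 𝒢 + I`. -/
structure IsOmega (U : Set (Eu n)) (s : Fin m → Eu n → Eu n)
    (Ω : Eu n → Matrix (Fin m) (Fin m) ℝ) : Prop where
  smooth : ∀ a b, ContDiffOn ℝ ∞ (fun u => Ω u a b) U
  deriv_eq : ∀ k, ∀ u ∈ U, pdMat k Ω u = (matG s u)ᵀ * pdMat k (matG s) u
  symm_eq : ∀ u ∈ U, Ω u + (Ω u)ᵀ = (matG s u)ᵀ * matG s u + 1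

/-- The `(n+m) × m` matrix `W` with upper block `𝒢 Ω⁻¹` and lower block `I - Ω⁻¹`. -/
noncomputable def matW (s : Fin m → Eu n → Eu n) (Ω : Eu n → Matrix (Fin m) (Fin m) ℝ) (u : Eu n) :
    Matrix (Fin n ⊕ Fin m) (Fin m) ℝ :=
  Matrix.fromRows (matG s u * (Ω u)⁻¹) (1 - (Ω u)⁻¹)

/-- The `a`-th column of `W`, as a map into `ℝⁿ⁺ᵐ`. -/
noncomputable def colW (s : Fin m → Eu n → Eu n) (Ω : Eu n → Matrix (Fin m) (Fin m) ℝ) (a : Fin m)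
    (u : Eu n) : Amb n m :=
  WithLp.toLp 2 fun r => matW s Ω u r a

end Systems

end Ferapontov

open Ferapontov

/-!
Both directions go through *parallel frames*: smooth orthonormal vectors `ξ_k` and `W_b` spanning
`ℝⁿ⁺ᵐ` with `∂W_b/∂u_k = V_kb ξ_k`. Where all `V_ka` are nonzero, `W_a` is an immersion into the
sphere whose coordinate vectors are multiples of the orthonormal `ξ_k`; the remaining `W_b` are
parallel normal fields, so the normal bundle is flat, and differentiating `⟨W_b, ∂W_a/∂u_j⟩ = 0` in
the direction `u_i` shows that the coordinates are principal (`IsParallelFrame.hasFlatNormalBundle`,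
`IsParallelFrame.hasPrincipalCoordinates`).

**Direct part.** The system for `X` has the form `∂X_i/∂u_j = ∑_l c_j(i,l) X_l` with `c_j`
antisymmetric, so `XXᵗ` is constant, and `X` is orthogonal everywhere if it is so at one point. By
the equations for `H` and `X` the form `∑ H_k X_k du_k` is closed, and so is `𝒢ᵗ d𝒢`; primitives
exist on a simply connected set because the germs of local primitives form a covering space, to
which the identity lifts (`exists_primitive`). The matrix `Ω + Ωᵗ - 𝒢ᵗ𝒢` is constant, and adding a
constant matrix to `Ω` makes it the identity. If `Ω + Ωᵗ = 𝒢ᵗ𝒢 + 1`, then `Ωv = 0` gives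
`|𝒢v|² + |v|² = 0`, hence `Ω` is invertible, and with `A = Ω⁻¹ 𝒢ᵗ X` the columns of the matrix with
blocks `X - 𝒢A` and `A` complete the columns of `W` to a parallel frame (`isParallelFrame_colW`).

**Converse.** Let `P(u)` be the orthogonal projection onto the normal space of the immersion at `u`.
Flatness means that the partial derivatives of `P` commute on the normal spaces, which is the
integrability condition of `dc = (dP) c`, the equation of parallel normal fields. Solutions are
built along rays from the base point; a Gronwall estimate comparing neighbouring rays shows that
they solve the equation in all directions (`exists_parallel_section`). An orthonormal basis of the
normal space thus extends to parallel normal fields. As the second fundamental form is diagonal,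
their derivatives along `u_k` are multiples of the `k`-th coordinate vector, so that with the
position vector in the place of `W_a` they form a parallel frame
(`IsPrincipalImmersion.exists_isParallelFrame`).

Let `W₁, W₂` and `Ξ₁, Ξ₂` be the blocks of the matrices with columns `W_b` and `ξ_k`. If `1 - W₂` is
invertible, put `Ω = (1 - W₂)⁻¹`, `𝒢 = W₁ Ω` and `X = Ξ₁ + 𝒢 Ξ₂`. Orthogonality of the full matrix
gives `Ω + Ωᵗ = 𝒢ᵗ𝒢 + 1`, `XᵗX = 1` and `𝒢ᵗX = ΩΞ₂`, whence `dΩ = 𝒢ᵗ d𝒢`, and `∂s_b/∂u_k` is a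
multiple of `X_k`. The mixed derivatives of the `s_b` force `⟨∂_j X_k, X_l⟩ = 0` for distinct
indices, because up to nonzero factors this is symmetric in `j, k` and antisymmetric in `k, l`; so
`X` and `H` satisfy the linear systems with `β_ij = ⟨∂_j X_i, X_j⟩`, and the mixed derivatives of
`X` are the Lamé equations (`IsOrthonormalPotential.isRotation`). Finally, if `W_a ≠ e_{n+a}` at the
base point, a constant rotation of the other columns makes `1 - W₂` invertible: composing with
reflections shrinks the space of coincidences of the two isometries involved until it vanishes
(`exists_isometry_forall_ne`). If `W_a = e_{n+a}`, one replaces the immersion by its antipode.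
-/

namespace Ferapontov

/-! ### Partial derivatives on open sets -/

section PartialDerivatives

variable {n : ℕ} {F : Type*} [NormedAddCommGroup F] [NormedSpace ℝ F]
  {U : Set (Eu n)} {f g : Eu n → F} {u : Eu n}

lemma eu_eq_sum (v : Eu n) : v = ∑ k, v k • (EuclideanSpace.single k 1 : Eu n) := by
  ext i
  simp [Finset.sum_apply, Pi.single_apply]

lemma clm_apply_eq_sum (L : Eu n →L[ℝ] F) (v : Eu n) :
    L v = ∑ k, v k • L (EuclideanSpace.single k 1) := by
  conv_lhs => rw [eu_eq_sum v]
  simp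

lemma fderiv_apply_eq_sum (v : Eu n) : fderiv ℝ f u v = ∑ k, v k • pd k f u :=
  clm_apply_eq_sum _ v

lemma pd_of_hasFDerivAt {L : Eu n →L[ℝ] F} (h : HasFDerivAt f L u) (k : Fin n) :
    pd k f u = L (EuclideanSpace.single k 1) := by
  rw [pd, h.fderiv]

lemma pd_congr (h : f =ᶠ[nhds u] g) (k : Fin n) : pd k f u = pd k g u := by
  rw [pd, pd, h.fderiv_eq]

lemma pd_congr_on (hU : IsOpen U) (hu : u ∈ U) (h : ∀ v ∈ U, f v = g v) (k : Fin n) :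
    pd k f u = pd k g u :=
  pd_congr (Filter.eventuallyEq_of_mem (hU.mem_nhds hu) h) k

lemma diffAt (hU : IsOpen U) (hf : ContDiffOn ℝ ∞ f U) (hu : u ∈ U) : DifferentiableAt ℝ f u :=
  (hf.contDiffAt (hU.mem_nhds hu)).differentiableAt (by simp)

lemma contDiffOn_fderiv (hU : IsOpen U) (hf : ContDiffOn ℝ ∞ f U) :
    ContDiffOn ℝ ∞ (fderiv ℝ f) U :=
  hf.fderiv_of_isOpen hU (by simp)

lemma contDiffOn_pd (hU : IsOpen U) (hf : ContDiffOn ℝ ∞ f U) (k : Fin n) :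
    ContDiffOn ℝ ∞ (pd k f) U :=
  (contDiffOn_fderiv hU hf).clm_apply contDiffOn_const

lemma fderiv_fderiv_apply (hU : IsOpen U) (hf : ContDiffOn ℝ ∞ f U) (hu : u ∈ U) (v w : Eu n) :
    fderiv ℝ (fun x => fderiv ℝ f x w) u v = fderiv ℝ (fderiv ℝ f) u v w := by
  have := (diffAt hU (contDiffOn_fderiv hU hf) hu).hasFDerivAt.clm_apply (hasFDerivAt_const w u)
  rw [this.fderiv]
  simp

/-- Mixed second partial derivatives commute. -/
lemma pd_comm (hU : IsOpen U) (hf : ContDiffOn ℝ ∞ f U) (hu : u ∈ U) (j k : Fin n) :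
    pd j (pd k f) u = pd k (pd j f) u := by
  have h := (hf.contDiffAt (hU.mem_nhds hu)).isSymmSndFDerivAt
    (by simpa using (WithTop.coe_le_coe.2 le_top : ((2 : ℕ∞) : WithTop ℕ∞) ≤ ∞))
  change fderiv ℝ (fun x => fderiv ℝ f x _) u _ = fderiv ℝ (fun x => fderiv ℝ f x _) u _
  rw [fderiv_fderiv_apply hU hf hu, fderiv_fderiv_apply hU hf hu]
  exact h _ _

lemma pd_const (k : Fin n) (c : F) : pd k (fun _ => c) u = 0 := by simp [pd]

lemma pd_add (hf : DifferentiableAt ℝ f u) (hg : DifferentiableAt ℝ g u) (k : Fin n) :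
    pd k (fun v => f v + g v) u = pd k f u + pd k g u := by
  simp [pd, fderiv_fun_add hf hg]

lemma pd_sub (hf : DifferentiableAt ℝ f u) (hg : DifferentiableAt ℝ g u) (k : Fin n) :
    pd k (fun v => f v - g v) u = pd k f u - pd k g u := by
  simp [pd, fderiv_fun_sub hf hg]

lemma pd_neg (k : Fin n) : pd k (fun v => -f v) u = -pd k f u := by
  simp [pd]

lemma pd_sum {ι : Type*} (s : Finset ι) {f : ι → Eu n → F}
    (hf : ∀ i ∈ s, DifferentiableAt ℝ (f i) u) (k : Fin n) :
    pd k (fun v => ∑ i ∈ s, f i v) u = ∑ i ∈ s, pd k (f i) u := by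
  simp [pd, fderiv_fun_sum hf]

lemma pd_smul {c : Eu n → ℝ} (hc : DifferentiableAt ℝ c u) (hf : DifferentiableAt ℝ f u)
    (k : Fin n) : pd k (fun v => c v • f v) u = c u • pd k f u + pd k c u • f u := by
  simp [pd, fderiv_fun_smul hc hf]

lemma pd_mul {c d : Eu n → ℝ} (hc : DifferentiableAt ℝ c u) (hd : DifferentiableAt ℝ d u)
    (k : Fin n) : pd k (fun v => c v * d v) u = pd k c u * d u + c u * pd k d u := by
  have := pd_smul hc hd k
  simp only [smul_eq_mul] at this
  rw [this, add_comm]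

lemma pd_clm {F' : Type*} [NormedAddCommGroup F'] [NormedSpace ℝ F'] (L : F →L[ℝ] F')
    (hf : DifferentiableAt ℝ f u) (k : Fin n) : pd k (fun v => L (f v)) u = L (pd k f u) := by
  have := (L.hasFDerivAt.comp u hf.hasFDerivAt).fderiv
  simp only [Function.comp_def] at this
  simp [pd, this]

lemma pd_clm_apply {F' : Type*} [NormedAddCommGroup F'] [NormedSpace ℝ F']
    {A : Eu n → F →L[ℝ] F'} (hA : DifferentiableAt ℝ A u) (hf : DifferentiableAt ℝ f u)
    (k : Fin n) : pd k (fun v => A v (f v)) u = pd k A u (f u) + A u (pd k f u) := by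
  have := hA.hasFDerivAt.clm_apply hf.hasFDerivAt
  simp [pd, this.fderiv, add_comm]

lemma pd_coord {ι : Type*} [Fintype ι] {s : Eu n → EuclideanSpace ℝ ι}
    (hs : DifferentiableAt ℝ s u) (k : Fin n) (i : ι) :
    pd k (fun v => s v i) u = pd k s u i :=
  pd_clm (EuclideanSpace.proj (𝕜 := ℝ) i) hs k

lemma pd_inner {F : Type*} [NormedAddCommGroup F] [InnerProductSpace ℝ F] {f g : Eu n → F}
    (hf : DifferentiableAt ℝ f u) (hg : DifferentiableAt ℝ g u) (k : Fin n) :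
    pd k (fun v => inner ℝ (f v) (g v)) u =
      inner ℝ (pd k f u) (g u) + inner ℝ (f u) (pd k g u) := by
  have := (hf.hasFDerivAt.inner ℝ hg.hasFDerivAt).fderiv
  simp [pd, this, add_comm]

lemma contDiffOn_coord_iff {ι : Type*} [Fintype ι] {s : Eu n → EuclideanSpace ℝ ι} :
    ContDiffOn ℝ ∞ s U ↔ ∀ i, ContDiffOn ℝ ∞ (fun u => s u i) U :=
  contDiffOn_euclidean

/-- A differentiable map all of whose partial derivatives are smooth is smooth. -/
lemma contDiffOn_of_pd (hU : IsOpen U) (hd : ∀ u ∈ U, DifferentiableAt ℝ f u)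
    (h : ∀ k, ContDiffOn ℝ ∞ (pd k f) U) : ContDiffOn ℝ ∞ f U := by
  rw [contDiffOn_infty_iff_fderiv_of_isOpen hU]
  refine ⟨fun u hu => (hd u hu).differentiableWithinAt, ?_⟩
  rw [contDiffOn_clm_apply]
  intro v
  simp only [fderiv_apply_eq_sum]
  exact ContDiffOn.sum fun k _ => contDiffOn_const.smul (h k)

lemma eq_of_pd_eq_zero (hU : IsOpen U) (hc : IsPreconnected U)
    (hd : ∀ u ∈ U, DifferentiableAt ℝ f u) (h : ∀ k, ∀ u ∈ U, pd k f u = 0) {u v : Eu n}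
    (hu : u ∈ U) (hv : v ∈ U) : f u = f v := by
  refine hU.is_const_of_fderiv_eq_zero hc (fun u hu => (hd u hu).differentiableWithinAt) ?_ hu hv
  intro u hu
  ext1 w
  simp [fderiv_apply_eq_sum, h _ u hu]

end PartialDerivatives

section MatrixDerivatives

variable {n : ℕ} {ι κ μ : Type*} {U : Set (Eu n)} {u : Eu n}

lemma pdMat_mul [Fintype κ] {A : Eu n → Matrix ι κ ℝ} {B : Eu n → Matrix κ μ ℝ}
    (hA : ∀ a b, DifferentiableAt ℝ (fun v => A v a b) u)
    (hB : ∀ a b, DifferentiableAt ℝ (fun v => B v a b) u) (k : Fin n) :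
    pdMat k (fun v => A v * B v) u = pdMat k A u * B u + A u * pdMat k B u := by
  ext a b
  simp only [pdMat, Matrix.of_apply, Matrix.mul_apply, Matrix.add_apply]
  rw [pd_sum _ (fun c _ => (hA a c).fun_mul (hB c b)), ← Finset.sum_add_distrib]
  exact Finset.sum_congr rfl fun c _ => pd_mul (hA a c) (hB c b) k

lemma pdMat_congr_on {A B : Eu n → Matrix ι κ ℝ} (hU : IsOpen U) (hu : u ∈ U)
    (h : ∀ v ∈ U, A v = B v) (k : Fin n) : pdMat k A u = pdMat k B u := by
  ext a b
  exact pd_congr_on hU hu (fun v hv => by rw [h v hv]) k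

lemma pdMat_const (A : Matrix ι κ ℝ) (k : Fin n) : pdMat k (fun _ => A) u = 0 := by
  ext a b
  exact pd_const k _

lemma pdMat_sub {A B : Eu n → Matrix ι κ ℝ}
    (hA : ∀ a b, DifferentiableAt ℝ (fun v => A v a b) u)
    (hB : ∀ a b, DifferentiableAt ℝ (fun v => B v a b) u) (k : Fin n) :
    pdMat k (fun v => A v - B v) u = pdMat k A u - pdMat k B u := by
  ext a b
  exact pd_sub (hA a b) (hB a b) k

lemma pdMat_transpose (A : Eu n → Matrix ι κ ℝ) (k : Fin n) :
    pdMat k (fun v => (A v)ᵀ) u = (pdMat k A u)ᵀ := rfl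

lemma contDiffOn_matrix_mul [Fintype κ] {A : Eu n → Matrix ι κ ℝ} {B : Eu n → Matrix κ μ ℝ}
    (hA : ∀ a b, ContDiffOn ℝ ∞ (fun v => A v a b) U)
    (hB : ∀ a b, ContDiffOn ℝ ∞ (fun v => B v a b) U) (a : ι) (b : μ) :
    ContDiffOn ℝ ∞ (fun v => (A v * B v) a b) U := by
  simp only [Matrix.mul_apply]
  exact ContDiffOn.sum fun c _ => (hA a c).mul (hB c b)

variable [Fintype κ] [DecidableEq κ]

lemma contDiffOn_det {A : Eu n → Matrix κ κ ℝ} (hA : ∀ a b, ContDiffOn ℝ ∞ (fun v => A v a b) U) :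
    ContDiffOn ℝ ∞ (fun v => (A v).det) U := by
  simp only [Matrix.det_apply]
  exact ContDiffOn.sum fun σ _ => (contDiffOn_prod fun i _ => hA _ _).const_smul _

lemma contDiffOn_matrix_inv {A : Eu n → Matrix κ κ ℝ}
    (hA : ∀ a b, ContDiffOn ℝ ∞ (fun v => A v a b) U) (hdet : ∀ u ∈ U, IsUnit (A u)) (a b : κ) :
    ContDiffOn ℝ ∞ (fun v => (A v)⁻¹ a b) U := by
  have h : ∀ v ∈ U, (A v).det ≠ 0 := fun v hv =>
    ((Matrix.isUnit_iff_isUnit_det _).1 (hdet v hv)).ne_zero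
  simp only [Matrix.inv_def, Ring.inverse_eq_inv', Matrix.smul_apply, smul_eq_mul,
    Matrix.adjugate_apply]
  refine ((contDiffOn_det hA).inv h).mul (contDiffOn_det fun c d => ?_)
  simp only [Matrix.updateRow_apply]
  split_ifs
  · exact contDiffOn_const
  · exact hA _ _

/-- The derivative of the inverse matrix is `-A⁻¹ (dA) A⁻¹`. -/
lemma pdMat_inv {A : Eu n → Matrix κ κ ℝ} (hU : IsOpen U)
    (hA : ∀ a b, ContDiffOn ℝ ∞ (fun v => A v a b) U) (hdet : ∀ u ∈ U, IsUnit (A u))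
    (hu : u ∈ U) (k : Fin n) :
    pdMat k (fun v => (A v)⁻¹) u = -((A u)⁻¹ * pdMat k A u * (A u)⁻¹) := by
  have hd : ∀ v ∈ U, IsUnit (A v).det := fun v hv => (Matrix.isUnit_iff_isUnit_det _).1 (hdet v hv)
  have h1 : pdMat k (fun v => A v * (A v)⁻¹) u = 0 := by
    rw [pdMat_congr_on hU hu (fun v hv => Matrix.mul_nonsing_inv _ (hd v hv)), pdMat_const]
  rw [pdMat_mul (fun a b => diffAt hU (hA a b) hu)
    (fun a b => diffAt hU (contDiffOn_matrix_inv hA hdet a b) hu)] at h1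
  have h2 := congrArg (fun B => (A u)⁻¹ * B) (eq_neg_of_add_eq_zero_right h1)
  simp only [← Matrix.mul_assoc, Matrix.mul_neg] at h2
  rwa [Matrix.nonsing_inv_mul _ (hd u hu), Matrix.one_mul] at h2

end MatrixDerivatives

/-! ### The Poincaré lemma on simply connected open sets -/

section Poincare

variable {E F : Type*} [NormedAddCommGroup E] [NormedSpace ℝ E] [NormedAddCommGroup F]
  [NormedSpace ℝ F]

/-- A type with the discrete topology: the fibre of the covering space of local primitives. -/
structure Discrete (F : Type*) where
  val : F

instance (F : Type*) : TopologicalSpace (Discrete F) := ⊥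

instance (F : Type*) : DiscreteTopology (Discrete F) := ⟨rfl⟩

/-- The covering space of `U` whose points over `b` are the germs at `b` of primitives of a closed
`1`-form. It is given by primitives `p i` on the members `N i` of an open cover; a fibre
coordinate `v` over `N i` stands for the germ of `p i + v`. -/
def primitiveCover {U : Set E} (N : U → Set E) (p : U → E → F) (hN : ∀ i, IsOpen (N i))
    (hmem : ∀ i : U, (i : E) ∈ N i)
    (hp : ∀ i j, ∀ b ∈ N i ∩ N j, ∀ᶠ x in nhds b, p i x - p j x = p i b - p j b) :
    FiberBundleCore U U (Discrete F) where
  baseSet i := Subtype.val ⁻¹' N i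
  isOpen_baseSet i := (hN i).preimage continuous_subtype_val
  indexAt := id
  mem_baseSet_at := hmem
  coordChange i j b v := ⟨v.val + (p i b - p j b)⟩
  coordChange_self i b _ v := by simp
  coordChange_comp i j k b _ v := by simp [add_assoc]
  continuousOn_coordChange i j := by
    rintro ⟨b, v⟩ ⟨hb, -⟩
    refine ContinuousAt.continuousWithinAt ?_
    refine Filter.Tendsto.mono_right ?_ (pure_le_nhds _)
    refine Filter.tendsto_pure.2 ?_
    have h0 : Filter.Tendsto (fun x : U × Discrete F => (x.1 : E)) (nhds (b, v)) (nhds b) :=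
      (continuous_subtype_val.comp continuous_fst).continuousAt
    have h1 : ∀ᶠ x : U × Discrete F in nhds (b, v), p i x.1 - p j x.1 = p i b - p j b :=
      h0.eventually (hp i j b hb)
    have h2 : ∀ᶠ x : U × Discrete F in nhds (b, v), x.2 = v := by
      have := (continuous_snd (X := U) (Y := Discrete F)).continuousAt (x := (b, v))
      rwa [ContinuousAt, nhds_discrete (Discrete F), Filter.tendsto_pure] at this
    filter_upwards [h1, h2] with x h1 h2
    rw [h1, h2]

/-- A closed `1`-form on a simply connected open set has a primitive. The identity of `U` lifts to
the covering space of germs of local primitives, and evaluating these germs glues them. -/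
theorem exists_primitive {U : Set E} (hU : IsOpen U) (hs : SimplyConnectedSpace U)
    {η : E → E →L[ℝ] F} [CompleteSpace F] (hη : DifferentiableOn ℝ η U)
    (hsymm : ∀ a ∈ U, ∀ x y, fderiv ℝ η a x y = fderiv ℝ η a y x) :
    ∃ f : E → F, ∀ u ∈ U, HasFDerivAt f (η u) u := by
  classical
  have hloc : ∀ i : U, ∃ N : Set E, IsOpen N ∧ (i : E) ∈ N ∧ N ⊆ U ∧ ∃ p : E → F,
      ∀ a ∈ N, HasFDerivAt p (η a) a := by
    intro i
    obtain ⟨r, hr, hrU⟩ := Metric.isOpen_iff.1 hU i i.2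
    refine ⟨Metric.ball i r, Metric.isOpen_ball, Metric.mem_ball_self hr, hrU, ?_⟩
    exact (convex_ball _ _).exists_forall_hasFDerivAt_of_fderiv_symmetric Metric.isOpen_ball
      (hη.mono hrU) fun a ha => hsymm a (hrU ha)
  choose N hN hmem hNU p hp using hloc
  have hdiff : ∀ i j, ∀ b ∈ N i ∩ N j, ∀ᶠ x in nhds b, p i x - p j x = p i b - p j b := by
    intro i j b hb
    obtain ⟨r, hr, hrN⟩ := Metric.isOpen_iff.1 ((hN i).inter (hN j)) b hb
    filter_upwards [Metric.ball_mem_nhds b hr] with x hx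
    have hd : ∀ y ∈ Metric.ball b r, HasFDerivAt (fun z => p i z - p j z) (0 : E →L[ℝ] F) y := by
      intro y hy
      have := (hp i y (hrN hy).1).fun_sub (hp j y (hrN hy).2)
      rwa [sub_self] at this
    exact Metric.isOpen_ball.is_const_of_fderiv_eq_zero (convex_ball b r).isPreconnected
      (fun y hy => (hd y hy).differentiableAt.differentiableWithinAt)
      (fun y hy => (hd y hy).fderiv) hx (Metric.mem_ball_self hr)
  let Z := primitiveCover N p hN hmem hdiff
  have cov : IsCoveringMap (Bundle.TotalSpace.proj : Z.TotalSpace → U) :=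
    FiberBundle.isCoveringMap (F := Discrete F) (E := Z.Fiber)
  have : LocallyPathConnectedSpace U := hU.locallyPathConnectedSpace
  obtain ⟨u₀⟩ : Nonempty U := inferInstance
  obtain ⟨σ, ⟨-, hσ⟩, -⟩ := cov.existsUnique_continuousMap_lifts (ContinuousMap.id U) u₀
    ⟨u₀, ⟨0⟩⟩ rfl
  have hσ' : ∀ u, (σ u).proj = u := fun u => congrFun hσ u
  let f : E → F := fun x => if hx : x ∈ U then
    (σ ⟨x, hx⟩).2.val + p (σ ⟨x, hx⟩).proj x else 0
  refine ⟨f, fun u hu => ?_⟩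
  let i : U := ⟨u, hu⟩
  have hcont : ContinuousAt (fun x : U => (Z.localTriv i (σ x)).2) i := by
    refine continuous_snd.continuousAt.comp
      (ContinuousAt.comp ?_ σ.continuous.continuousAt)
    refine (Z.localTriv i).continuousOn.continuousAt ((Z.localTriv i).open_source.mem_nhds ?_)
    rw [Z.mem_localTriv_source, hσ']
    exact hmem i
  rw [ContinuousAt, nhds_discrete (Discrete F), Filter.tendsto_pure] at hcont
  have hev : ∀ᶠ x in nhds u, f x = (Z.localTriv i (σ i)).2.val + p i x := by
    have h1 := hcont
    rw [nhds_subtype_eq_comap, Filter.eventually_comap] at h1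
    filter_upwards [h1, hU.mem_nhds hu] with x h1 hx
    have h2 := h1 ⟨x, hx⟩ rfl
    rw [← h2]
    have h3 : (Z.localTriv i (σ ⟨x, hx⟩)).2.val =
      (σ ⟨x, hx⟩).2.val +
        (p (σ ⟨x, hx⟩).proj (σ ⟨x, hx⟩).proj - p i (σ ⟨x, hx⟩).proj) := rfl
    simp only [f, dif_pos hx]
    rw [h3]
    simp only [hσ']
    abel
  exact ((hp i u (hmem i)).const_add _).congr_of_eventuallyEq hev

/-- Given functions `w k` on a simply connected open set with `∂w_k/∂u_j = ∂w_j/∂u_k`, there is a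
smooth function whose partial derivatives are the `w k`. -/
theorem exists_potential {n : ℕ} [CompleteSpace F] {U : Set (Eu n)} (hU : IsOpen U)
    (hs : SimplyConnectedSpace U) {w : Fin n → Eu n → F} (hw : ∀ k, ContDiffOn ℝ ∞ (w k) U)
    (hc : ∀ j k, ∀ u ∈ U, pd j (w k) u = pd k (w j) u) :
    ∃ f : Eu n → F, ContDiffOn ℝ ∞ f U ∧ ∀ k, ∀ u ∈ U, pd k f u = w k u := by
  let η : Eu n → Eu n →L[ℝ] F := fun u =>
    ∑ k, (EuclideanSpace.proj (𝕜 := ℝ) k : Eu n →L[ℝ] ℝ).smulRight (w k u)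
  have hηa : ∀ u v, η u v = ∑ k, v k • w k u := fun u v => by
    simp [η]
  have hη : ContDiffOn ℝ ∞ η U := by
    rw [contDiffOn_clm_apply]
    intro v
    simp only [hηa]
    exact ContDiffOn.sum fun k _ => contDiffOn_const.smul (hw k)
  have hfd : ∀ u ∈ U, ∀ x y, fderiv ℝ η u x y = ∑ j, ∑ k, (x j * y k) • pd j (w k) u := by
    intro u hu x y
    have h1 := (diffAt hU hη hu).hasFDerivAt.clm_apply (hasFDerivAt_const y u)
    have h2 : fderiv ℝ (fun v => η v y) u x = fderiv ℝ η u x y := by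
      rw [h1.fderiv]; simp
    rw [← h2, fderiv_apply_eq_sum]
    refine Finset.sum_congr rfl fun j _ => ?_
    have h3 : pd j (fun v => η v y) u = ∑ k, y k • pd j (w k) u := by
      simp only [hηa]
      rw [pd_sum _ fun k _ => (diffAt hU (hw k) hu).fun_const_smul (y k)]
      exact Finset.sum_congr rfl fun k _ => pd_clm (y k • ContinuousLinearMap.id ℝ F)
        (diffAt hU (hw k) hu) j
    rw [h3, Finset.smul_sum]
    simp only [smul_smul]
  obtain ⟨f, hf⟩ := exists_primitive hU hs (hη.differentiableOn (by simp)) (by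
    intro u hu x y
    rw [hfd u hu, hfd u hu, Finset.sum_comm]
    refine Finset.sum_congr rfl fun j _ => Finset.sum_congr rfl fun k _ => ?_
    rw [hc k j u hu, mul_comm])
  have hpd : ∀ k, ∀ u ∈ U, pd k f u = w k u := by
    intro k u hu
    rw [pd_of_hasFDerivAt (hf u hu), hηa]
    simp
  refine ⟨f, contDiffOn_of_pd hU (fun u hu => (hf u hu).differentiableAt) (fun k => ?_), hpd⟩
  exact (hw k).congr (hpd k)

end Poincare

/-! ### Integrability of the linear systems, and their consequences -/

section Direct

variable {n m : ℕ} {U : Set (Eu n)} {β : Fin n → Fin n → Eu n → ℝ}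

lemma IsRotation.lameIntegrable (h : IsRotation U β) : LameIntegrable U β := by
  intro i j k hij hjk hki u hu x
  rw [h.eq_triple i j k hij hjk hki u hu,
    h.eq_triple k j i hjk.symm hij.symm hki.symm u hu]
  ring

lemma frameCoeff_of_ne {j i l : Fin n} (h : i ≠ j) (h' : l ≠ j) :
    frameCoeff β j i l = fun _ => 0 := by
  funext u; simp [frameCoeff, h, h']

lemma frameCoeff_ne_eq {j i : Fin n} (h : i ≠ j) : frameCoeff β j i j = β i j := by
  funext u; simp [frameCoeff, h]

lemma frameCoeff_self (i : Fin n) : frameCoeff β i i i = fun _ => 0 := by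
  funext u; simp [frameCoeff]

lemma frameCoeff_self_ne {i l : Fin n} (h : l ≠ i) :
    frameCoeff β i i l = fun u => -β l i u := by
  funext u; simp [frameCoeff, h]

lemma frameCoeff_antisymm (k i l : Fin n) (u : Eu n) :
    frameCoeff β k l i u = -frameCoeff β k i l u := by
  by_cases hl : l = k <;> by_cases hi : i = k <;> simp [frameCoeff, hl, hi]

lemma sum_frameCoeff_ne {M : Type*} [AddCommGroup M] [Module ℝ M] {j i : Fin n} (h : i ≠ j)
    (f : Fin n → M) (u : Eu n) : ∑ p, frameCoeff β j i p u • f p = β i j u • f j := by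
  rw [Finset.sum_eq_single j _ (by simp), frameCoeff_ne_eq h]
  intro p _ hp
  simp [frameCoeff_of_ne h hp]

lemma sum_frameCoeff_self {M : Type*} [AddCommGroup M] [Module ℝ M] (i : Fin n)
    (f : Fin n → M) (u : Eu n) : ∑ p, frameCoeff β i i p u • f p =
      -∑ p ∈ Finset.univ.filter (fun p => p ≠ i), β p i u • f p := by
  rw [Finset.sum_filter, ← Finset.sum_neg_distrib]
  refine Finset.sum_congr rfl fun p _ => ?_
  by_cases hp : p = i
  · simp [hp, frameCoeff_self]
  · simp [hp, frameCoeff_self_ne hp]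

/-- The integrability condition of the frame system for `X_i` in the directions `i` and `k`. -/
lemma IsRotation.frameIntegrable_self (h : IsRotation U β) {i k : Fin n} (hik : i ≠ k) (l : Fin n)
    {u : Eu n} (hu : u ∈ U) :
    pd k (frameCoeff β i i l) u + ∑ p, frameCoeff β i i p u * frameCoeff β k p l u =
      pd i (frameCoeff β k i l) u + ∑ p, frameCoeff β k i p u * frameCoeff β i p l u := by
  have h1 := sum_frameCoeff_ne (β := β) hik (fun p => frameCoeff β i p l u) u
  have h2 := sum_frameCoeff_self (β := β) i (fun p => frameCoeff β k p l u) u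
  simp only [smul_eq_mul] at h1 h2
  rw [h1, h2]
  by_cases hli : l = i
  · subst hli
    rw [frameCoeff_self, frameCoeff_of_ne hik hik, frameCoeff_ne_eq hik.symm,
      Finset.sum_eq_single k, frameCoeff_self_ne hik, pd_const, pd_const]
    · ring
    · intro p _ hp
      simp [frameCoeff_of_ne hp hik]
    · simp [hik.symm]
  by_cases hlk : l = k
  · subst hlk
    rw [frameCoeff_self_ne hli, frameCoeff_ne_eq hik, frameCoeff_of_ne hli hik.symm,
      pd_neg (f := β l i)]
    have h3 := h.eq_pair i l hik u hu
    have h4 : ∑ p ∈ Finset.univ.filter (fun p => p ≠ i), β p i u * frameCoeff β l p l u =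
        ∑ p ∈ Finset.univ.filter (fun p => p ≠ i ∧ p ≠ l), β p i u * β p l u := by
      rw [← Finset.filter_filter, Finset.sum_filter (fun p => p ≠ l)]
      refine Finset.sum_congr rfl fun p _ => ?_
      by_cases hp : p = l
      · simp [hp, frameCoeff_self]
      · simp [hp, frameCoeff_ne_eq]
    rw [h4]
    linarith
  · rw [frameCoeff_self_ne hli, frameCoeff_of_ne hik hlk, frameCoeff_of_ne hik.symm hli,
      Finset.sum_eq_single k, frameCoeff_self_ne hlk, pd_const, pd_neg (f := β l i),
      h.eq_triple l i k hli hik (Ne.symm hlk) u hu]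
    · ring
    · intro p _ hp
      simp [frameCoeff_of_ne hp hlk]
    · simp [hik.symm]

lemma IsRotation.frameIntegrable (h : IsRotation U β) : FrameIntegrable U β := by
  intro i j k l u hu
  by_cases hjk : j = k
  · rw [hjk]
  by_cases hij : i = j
  · subst hij
    exact h.frameIntegrable_self hjk l hu
  by_cases hik : i = k
  · subst hik
    exact (h.frameIntegrable_self hij l hu).symm
  have h1 := sum_frameCoeff_ne (β := β) hij (fun p => frameCoeff β k p l u) u
  have h2 := sum_frameCoeff_ne (β := β) hik (fun p => frameCoeff β j p l u) u
  simp only [smul_eq_mul] at h1 h2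
  rw [h1, h2]
  by_cases hlj : l = j
  · subst hlj
    rw [frameCoeff_ne_eq hij, frameCoeff_of_ne hik hjk, frameCoeff_of_ne hjk hjk,
      frameCoeff_ne_eq (Ne.symm hjk), pd_const, h.eq_triple i l k hij hjk (Ne.symm hik) u hu]
    ring
  by_cases hlk : l = k
  · subst hlk
    rw [frameCoeff_ne_eq hik, frameCoeff_of_ne hij hlj, frameCoeff_of_ne hlj hlj,
      frameCoeff_ne_eq (Ne.symm hlj), pd_const,
      h.eq_triple i l j hik (Ne.symm hjk) (Ne.symm hij) u hu]
    ring
  · rw [frameCoeff_of_ne hij hlj, frameCoeff_of_ne hik hlk, frameCoeff_of_ne hjk hlk,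
      frameCoeff_of_ne (Ne.symm hjk) hlj, pd_const, pd_const]
    ring

variable {X : Fin n → Eu n → Eu n} {H : Fin n → Eu n → ℝ} {s : Eu n → Eu n}

lemma IsLameFrame.pd_eq (h : IsLameFrame U β X) (j i : Fin n) {u : Eu n} (hu : u ∈ U) :
    pd j (X i) u = ∑ l, frameCoeff β j i l u • X l u := by
  by_cases hij : i = j
  · subst hij
    rw [h.eq_self i u hu, sum_frameCoeff_self]
  · rw [h.eq_ne i j hij u hu, sum_frameCoeff_ne hij]

/-- The rows of the frame matrix stay orthonormal because the coefficients of the frame system are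
antisymmetric, so that `X Xᵗ` is constant. -/
lemma IsLameFrame.frameMatrix_transpose_mul (h : IsLameFrame U β X) (hU : IsOpen U)
    (hc : IsPreconnected U) {u : Eu n} (hu : u ∈ U) :
    (frameMatrix X u)ᵀ * frameMatrix X u = 1 := by
  obtain ⟨u₀, hu₀, h₀⟩ := h.orthonormal
  have hs : ∀ a b, ContDiffOn ℝ ∞ (fun v => frameMatrix X v a b) U := fun a b =>
    contDiffOn_coord_iff.1 (h.smooth b) a
  have hst : ∀ a b, ContDiffOn ℝ ∞ (fun v => (frameMatrix X v)ᵀ a b) U := fun a b => hs b a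
  rw [mul_eq_one_comm] at h₀ ⊢
  rw [← h₀]
  ext a b
  refine eq_of_pd_eq_zero (f := fun v => (frameMatrix X v * (frameMatrix X v)ᵀ) a b) hU hc
    (fun v hv => diffAt hU (contDiffOn_matrix_mul hs hst a b) hv) ?_ hu hu₀
  intro k v hv
  let C : Matrix (Fin n) (Fin n) ℝ := Matrix.of fun i l => frameCoeff β k i l v
  have hC : pdMat k (frameMatrix X) v = frameMatrix X v * Cᵀ := by
    ext a i
    change pd k (fun w => X i w a) v = _
    rw [pd_coord (diffAt hU (h.smooth i) hv), h.pd_eq k i hv]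
    simp [Matrix.mul_apply, frameMatrix, C, mul_comm]
  have hanti : Cᵀ = -C := by
    ext i l
    exact frameCoeff_antisymm k i l v
  have hp := pdMat_mul (fun a b => diffAt hU (hs a b) hv) (fun a b => diffAt hU (hst a b) hv) k
  rw [pdMat_transpose, hC, Matrix.transpose_mul, Matrix.transpose_transpose, hanti,
    Matrix.mul_neg, Matrix.neg_mul, Matrix.mul_assoc, neg_add_cancel] at hp
  exact congrFun (congrFun hp a) b

lemma IsLameFrame.inner_eq (h : IsLameFrame U β X) (hU : IsOpen U)
    (hc : IsPreconnected U) {u : Eu n} (hu : u ∈ U) (i j : Fin n) :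
    inner ℝ (X i u) (X j u) = if i = j then 1 else 0 := by
  have := congrFun (congrFun (h.frameMatrix_transpose_mul hU hc hu) i) j
  rw [Matrix.one_apply] at this
  rw [← this]
  simp [Matrix.mul_apply, frameMatrix, PiLp.inner_apply, mul_comm]

lemma IsPotential.pd_eq (h : IsPotential U X H s) (hU : IsOpen U) {u : Eu n} (hu : u ∈ U)
    (k : Fin n) : pd k s u = H k u • X k u := by
  ext i
  rw [← pd_coord (diffAt hU h.smooth hu), h.eq i k u hu]
  simp [frameMatrix, mul_comm]

lemma isPotential_of_pd_eq (hU : IsOpen U) (hs : ContDiffOn ℝ ∞ s U)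
    (h : ∀ k, ∀ u ∈ U, pd k s u = H k u • X k u) : IsPotential U X H s := by
  refine ⟨hs, fun i k u hu => ?_⟩
  rw [pd_coord (diffAt hU hs hu), h k u hu]
  simp [frameMatrix, mul_comm]

/-- The form `∑ H_k X_k du_k` is closed, hence exact. -/
lemma exists_isPotential (hU : IsOpen U) (hsc : SimplyConnectedSpace U) (hH : IsLameFamily U β H)
    (hX : IsLameFrame U β X) : ∃ s, IsPotential U X H s := by
  obtain ⟨s, hs, hpd⟩ := exists_potential hU hsc (w := fun k u => H k u • X k u)
    (fun k => (hH.smooth k).smul (hX.smooth k)) (by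
      intro j k u hu
      rcases eq_or_ne j k with rfl | hjk
      · rfl
      rw [pd_smul (diffAt hU (hH.smooth k) hu) (diffAt hU (hX.smooth k) hu),
        pd_smul (diffAt hU (hH.smooth j) hu) (diffAt hU (hX.smooth j) hu),
        hX.eq_ne k j hjk.symm u hu, hX.eq_ne j k hjk u hu, hH.eq j k hjk u hu,
        hH.eq k j hjk.symm u hu]
      module)
  exact ⟨s, isPotential_of_pd_eq hU hs hpd⟩

variable {Hs : Fin m → Fin n → Eu n → ℝ} {S : Fin m → Eu n → Eu n}

lemma matG_transpose_mul_apply (S : Fin m → Eu n → Eu n) (u : Eu n) (a b : Fin m) :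
    ((matG S u)ᵀ * matG S u) a b = inner ℝ (S a u) (S b u) := by
  simp [Matrix.mul_apply, matG, PiLp.inner_apply, mul_comm]

lemma matG_transpose_mul_pdMat_apply {u : Eu n} (hS : ∀ a, DifferentiableAt ℝ (S a) u)
    (k : Fin n) (a b : Fin m) :
    ((matG S u)ᵀ * pdMat k (matG S) u) a b = inner ℝ (S a u) (pd k (S b) u) := by
  simp only [Matrix.mul_apply, matG, PiLp.inner_apply, pdMat, Matrix.transpose_apply,
    Matrix.of_apply]
  refine Finset.sum_congr rfl fun i _ => ?_
  rw [pd_coord (hS b)]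
  simp [mul_comm]

/-- The form `𝒢ᵗ d𝒢` is closed because the vectors `X_k` are orthogonal; the constants of
integration are fixed by the value of `Ω + Ωᵗ` at one point. -/
lemma exists_isOmega (hU : IsOpen U) (hsc : SimplyConnectedSpace U) (hX : IsLameFrame U β X)
    (hS : ∀ a, IsPotential U X (Hs a) (S a)) : ∃ Ω, IsOmega U S Ω := by
  have hc : IsPreconnected U := isPreconnected_iff_preconnectedSpace.2 inferInstance
  have hd : ∀ a, ∀ u ∈ U, DifferentiableAt ℝ (S a) u := fun a u hu => diffAt hU (hS a).smooth hu
  have hex : ∀ a b, ∃ f : Eu n → ℝ, ContDiffOn ℝ ∞ f U ∧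
      ∀ k, ∀ u ∈ U, pd k f u = inner ℝ (S a u) (pd k (S b) u) := by
    intro a b
    refine exists_potential hU hsc
      (fun k => (hS a).smooth.inner ℝ (contDiffOn_pd hU (hS b).smooth k)) ?_
    intro j k u hu
    have h1 : ∀ k, DifferentiableAt ℝ (pd k (S b)) u := fun k =>
      diffAt hU (contDiffOn_pd hU (hS b).smooth k) hu
    rw [pd_inner (hd a u hu) (h1 k), pd_inner (hd a u hu) (h1 j), pd_comm hU (hS b).smooth hu j k]
    simp only [fun a k => (hS a).pd_eq hU hu k, inner_smul_left, inner_smul_right,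
      hX.inner_eq hU hc hu]
    rcases eq_or_ne j k with rfl | hjk
    · rfl
    · simp [hjk, hjk.symm]
  choose f hf hpf using hex
  obtain ⟨⟨u₀, hu₀⟩⟩ : Nonempty U := inferInstance
  have hconst : ∀ a b, ∀ u ∈ U, f a b u + f b a u - inner ℝ (S a u) (S b u) =
      f a b u₀ + f b a u₀ - inner ℝ (S a u₀) (S b u₀) := by
    intro a b u hu
    have h1 : ∀ u ∈ U, DifferentiableAt ℝ (fun u => f a b u + f b a u) u := fun u hu =>
      (diffAt hU (hf a b) hu).fun_add (diffAt hU (hf b a) hu)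
    have h2 : ∀ u ∈ U, DifferentiableAt ℝ (fun u => inner ℝ (S a u) (S b u)) u := fun u hu =>
      (hd a u hu).inner ℝ (hd b u hu)
    refine eq_of_pd_eq_zero (f := fun u => f a b u + f b a u - inner ℝ (S a u) (S b u)) hU hc
      (fun u hu => (h1 u hu).fun_sub (h2 u hu)) ?_ hu hu₀
    intro k u hu
    rw [pd_sub (h1 u hu) (h2 u hu), pd_add (diffAt hU (hf a b) hu) (diffAt hU (hf b a) hu),
      pd_inner (hd a u hu) (hd b u hu), hpf a b k u hu, hpf b a k u hu,
      real_inner_comm (S b u) (pd k (S a) u)]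
    ring
  let c : Fin m → Fin m → ℝ := fun a b =>
    (f a b u₀ + f b a u₀ - inner ℝ (S a u₀) (S b u₀) - (1 : Matrix (Fin m) (Fin m) ℝ) a b) / 2
  refine ⟨fun u => Matrix.of fun a b => f a b u - c a b, ?_, ?_, ?_⟩
  · intro a b
    exact (hf a b).sub contDiffOn_const
  · intro k u hu
    ext a b
    rw [matG_transpose_mul_pdMat_apply (fun a => hd a u hu)]
    change pd k (fun v => f a b v - c a b) u = _
    rw [pd_sub (diffAt hU (hf a b) hu) (differentiableAt_const _), pd_const, hpf a b k u hu,
      sub_zero]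
  · intro u hu
    ext a b
    have h1 := hconst a b u hu
    rw [Matrix.add_apply, Matrix.add_apply, matG_transpose_mul_apply]
    have h2 : (1 : Matrix (Fin m) (Fin m) ℝ) b a = (1 : Matrix (Fin m) (Fin m) ℝ) a b := by
      simp [Matrix.one_apply, eq_comm]
    simp only [Matrix.transpose_apply, Matrix.of_apply, c, h2, real_inner_comm (S a u₀) (S b u₀)]
    linarith [real_inner_comm (S a u₀) (S b u₀)]

end Direct

/-! ### The algebra of the matrix `W` -/

section Algebra

variable {ι κ μ : Type*} [Fintype ι] [Fintype κ] [DecidableEq κ]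
  {G : Matrix ι κ ℝ} {Ω : Matrix κ κ ℝ}

/-- If the symmetric part of `2Ω` is `GᵗG + 1`, then `Ωv = 0` gives `|Gv|² + |v|² = 0`. -/
lemma isUnit_of_add_transpose (h : Ω + Ωᵀ = Gᵀ * G + 1) : IsUnit Ω := by
  rw [← Matrix.mulVec_injective_iff_isUnit]
  refine (injective_iff_map_eq_zero (Matrix.mulVecLin Ω)).2 fun v hv => ?_
  rw [Matrix.mulVecLin_apply] at hv
  have h1 : v ⬝ᵥ ((Ω + Ωᵀ) *ᵥ v) = 0 := by
    rw [Matrix.add_mulVec, hv, zero_add, Matrix.dotProduct_mulVec, Matrix.vecMul_transpose, hv,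
      zero_dotProduct]
  rw [h, Matrix.add_mulVec, Matrix.one_mulVec, dotProduct_add, ← Matrix.mulVec_mulVec,
    Matrix.dotProduct_mulVec, Matrix.vecMul_transpose] at h1
  have h2 : 0 ≤ (G *ᵥ v) ⬝ᵥ (G *ᵥ v) := Finset.sum_nonneg fun i _ => mul_self_nonneg _
  have h3 : 0 ≤ v ⬝ᵥ v := Finset.sum_nonneg fun i _ => mul_self_nonneg _
  exact dotProduct_self_eq_zero.1 (by linarith)

variable {R : Matrix κ κ ℝ}

lemma conj_add_transpose (h : Ω + Ωᵀ = Gᵀ * G + 1) (hR : Ω * R = 1) :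
    Rᵀ * (Gᵀ * (G * R)) + Rᵀ * R = R + Rᵀ := by
  have hR' : Rᵀ * Ωᵀ = 1 := by rw [← Matrix.transpose_mul, hR, Matrix.transpose_one]
  have h1 : Rᵀ * (Ω + Ωᵀ) * R = Rᵀ + R := by
    rw [Matrix.mul_add, Matrix.add_mul, hR', Matrix.one_mul, Matrix.mul_assoc, hR, Matrix.mul_one]
  rw [h, Matrix.mul_add, Matrix.add_mul, Matrix.mul_one] at h1
  rw [add_comm R, ← h1]
  simp only [Matrix.mul_assoc]

lemma fromRows_transpose_mul_self (h : Ω + Ωᵀ = Gᵀ * G + 1) (hR : Ω * R = 1) :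
    (Matrix.fromRows (G * R) (1 - R))ᵀ * Matrix.fromRows (G * R) (1 - R) = 1 := by
  rw [Matrix.transpose_fromRows, Matrix.fromCols_mul_fromRows]
  have h1 := conj_add_transpose h hR
  simp only [Matrix.transpose_mul, Matrix.transpose_sub, Matrix.transpose_one, Matrix.sub_mul,
    Matrix.mul_sub, Matrix.one_mul, Matrix.mul_one, Matrix.mul_assoc]
  rw [eq_sub_of_add_eq h1]
  abel

variable {X : Matrix ι μ ℝ} {A : Matrix κ μ ℝ}

lemma fromRows_tangent_transpose_mul_self [DecidableEq μ] (h : Ω + Ωᵀ = Gᵀ * G + 1)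
    (hA : Ω * A = Gᵀ * X) (hX : Xᵀ * X = 1) :
    (Matrix.fromRows (X - G * A) A)ᵀ * Matrix.fromRows (X - G * A) A = 1 := by
  rw [Matrix.transpose_fromRows, Matrix.fromCols_mul_fromRows]
  have hA' : Xᵀ * G = Aᵀ * Ωᵀ := by
    rw [← Matrix.transpose_mul, hA, Matrix.transpose_mul, Matrix.transpose_transpose]
  have h1 : Aᵀ * (Gᵀ * (G * A)) + Aᵀ * A = Aᵀ * (Gᵀ * X) + Xᵀ * (G * A) := by
    have h2 : Aᵀ * (Gᵀ * G + 1) * A = Aᵀ * (Ω + Ωᵀ) * A := by rw [h]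
    rw [Matrix.mul_add, Matrix.add_mul, Matrix.mul_one, Matrix.mul_add, Matrix.add_mul, ← hA',
      Matrix.mul_assoc Aᵀ Ω, hA] at h2
    simpa only [Matrix.mul_assoc] using h2
  simp only [Matrix.transpose_mul, Matrix.transpose_sub, Matrix.sub_mul,
    Matrix.mul_sub, Matrix.mul_assoc, hX]
  rw [eq_sub_of_add_eq h1]
  abel

lemma fromRows_tangent_transpose_mul (h : Ω + Ωᵀ = Gᵀ * G + 1) (hR : Ω * R = 1)
    (hA : Ω * A = Gᵀ * X) :
    (Matrix.fromRows (X - G * A) A)ᵀ * Matrix.fromRows (G * R) (1 - R) = 0 := by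
  rw [Matrix.transpose_fromRows, Matrix.fromCols_mul_fromRows]
  have hA' : Xᵀ * G = Aᵀ * Ωᵀ := by
    rw [← Matrix.transpose_mul, hA, Matrix.transpose_mul, Matrix.transpose_transpose]
  have h1 : Aᵀ * (Gᵀ * (G * R)) + Aᵀ * R = Aᵀ + Xᵀ * (G * R) := by
    have h2 : Aᵀ * (Gᵀ * G + 1) * R = Aᵀ * (Ω + Ωᵀ) * R := by rw [h]
    rw [Matrix.mul_add, Matrix.add_mul, Matrix.mul_one, Matrix.mul_add, Matrix.add_mul, ← hA',
      Matrix.mul_assoc Aᵀ Ω, hR, Matrix.mul_one] at h2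
    simpa only [Matrix.mul_assoc] using h2
  simp only [Matrix.transpose_mul, Matrix.transpose_sub, Matrix.sub_mul,
    Matrix.mul_sub, Matrix.mul_one, Matrix.mul_assoc]
  rw [eq_sub_of_add_eq h1]
  abel

end Algebra

/-! ### Parallel frames -/

section ParallelFrame

variable {n m : ℕ} {U : Set (Eu n)}

/-- A parallel frame on `U`: orthonormal vectors `ξ_k` and `W_b` that together span `ℝⁿ⁺ᵐ`,
with `∂W_b/∂u_k = V_kb ξ_k`. Any column `W_a` with nonzero `V_ka` is an immersion with tangent
spaces spanned by the `ξ_k` and with the other columns as parallel normal fields. -/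
structure IsParallelFrame (U : Set (Eu n)) (W : Fin m → Eu n → Amb n m)
    (ξ : Fin n → Eu n → Amb n m) (V : Fin n → Fin m → Eu n → ℝ) : Prop where
  smooth : ∀ b, ContDiffOn ℝ ∞ (W b) U
  orthonormal : ∀ u ∈ U, Orthonormal ℝ (Sum.elim (fun k => ξ k u) (fun b => W b u))
  pd_eq : ∀ k b, ∀ u ∈ U, pd k (W b) u = V k b u • ξ k u

/-- The column `j` of a matrix as a Euclidean vector. -/
noncomputable def colVec {ι κ : Type*} (A : Matrix ι κ ℝ) (j : κ) : EuclideanSpace ℝ ι :=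
  WithLp.toLp 2 fun r => A r j

lemma inner_colVec {ι κ μ : Type*} [Fintype ι] (A : Matrix ι κ ℝ) (B : Matrix ι μ ℝ) (i : κ)
    (j : μ) : inner ℝ (colVec A i) (colVec B j) = (Aᵀ * B) i j := by
  simp [colVec, Matrix.mul_apply, PiLp.inner_apply, mul_comm]

lemma orthonormal_sumElim_colVec {ι κ μ : Type*} [Fintype ι] [DecidableEq κ] [DecidableEq μ]
    {A : Matrix ι κ ℝ} {B : Matrix ι μ ℝ} (hA : Aᵀ * A = 1) (hB : Bᵀ * B = 1)
    (hAB : Aᵀ * B = 0) : Orthonormal ℝ (Sum.elim (colVec A) (colVec B)) := by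
  have hBA : Bᵀ * A = 0 := by
    rw [← Matrix.transpose_transpose A, ← Matrix.transpose_mul, hAB, Matrix.transpose_zero]
  rw [orthonormal_iff_ite]
  rintro (i | i) (j | j) <;>
    simp [inner_colVec, hA, hB, hAB, hBA, Matrix.one_apply]

variable {β : Fin n → Fin n → Eu n → ℝ} {X : Fin n → Eu n → Eu n}
  {H : Fin m → Fin n → Eu n → ℝ} {s : Fin m → Eu n → Eu n}
  {Ω : Eu n → Matrix (Fin m) (Fin m) ℝ}

lemma contDiffOn_matW (hs : ∀ a, ContDiffOn ℝ ∞ (s a) U)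
    (hR : ∀ a b, ContDiffOn ℝ ∞ (fun v => (Ω v)⁻¹ a b) U) (r : Fin n ⊕ Fin m) (a : Fin m) :
    ContDiffOn ℝ ∞ (fun v => matW s Ω v r a) U := by
  rcases r with i | b
  · exact contDiffOn_matrix_mul (A := fun v => matG s v) (B := fun v => (Ω v)⁻¹)
      (fun i b => contDiffOn_coord_iff.1 (hs b) i) hR i a
  · exact contDiffOn_const.sub (hR b a)

/-- The direct construction gives a parallel frame: with `A = Ω⁻¹ 𝒢ᵗ X`, the tangent vectors `ξ_k`
are the columns of the matrix with blocks `X - 𝒢 A` and `A`. -/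
theorem isParallelFrame_colW (hU : IsOpen U) (hc : IsPreconnected U) (hX : IsLameFrame U β X)
    (hs : ∀ a, IsPotential U X (H a) (s a)) (hΩ : IsOmega U s Ω) :
    IsParallelFrame U (colW s Ω)
      (fun k u => colVec (Matrix.fromRows
        (frameMatrix X u - matG s u * ((Ω u)⁻¹ * ((matG s u)ᵀ * frameMatrix X u)))
        ((Ω u)⁻¹ * ((matG s u)ᵀ * frameMatrix X u))) k)
      (fun k b u => ∑ c, H c k u * (Ω u)⁻¹ c b) := by
  have hu : ∀ u ∈ U, IsUnit (Ω u) := fun u hu => isUnit_of_add_transpose (hΩ.symm_eq u hu)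
  have hR : ∀ a b, ContDiffOn ℝ ∞ (fun v => (Ω v)⁻¹ a b) U := contDiffOn_matrix_inv hΩ.smooth hu
  have hG : ∀ i a, ContDiffOn ℝ ∞ (fun v => matG s v i a) U := fun i a =>
    contDiffOn_coord_iff.1 (hs a).smooth i
  have hW := contDiffOn_matW (fun a => (hs a).smooth) hR
  have hdet : ∀ u ∈ U, Ω u * (Ω u)⁻¹ = 1 := fun u hv =>
    Matrix.mul_nonsing_inv _ ((Matrix.isUnit_iff_isUnit_det _).1 (hu u hv))
  have hsm : ∀ b, ContDiffOn ℝ ∞ (colW s Ω b) U := fun b =>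
    contDiffOn_coord_iff.2 fun r => hW r b
  refine ⟨hsm, ?_, ?_⟩
  · intro u hv
    have hA : Ω u * ((Ω u)⁻¹ * ((matG s u)ᵀ * frameMatrix X u)) =
        (matG s u)ᵀ * frameMatrix X u := by
      rw [← Matrix.mul_assoc, hdet u hv, Matrix.one_mul]
    exact orthonormal_sumElim_colVec
      (fromRows_tangent_transpose_mul_self (hΩ.symm_eq u hv) hA
        (hX.frameMatrix_transpose_mul hU hc hv))
      (fromRows_transpose_mul_self (hΩ.symm_eq u hv) (hdet u hv))
      (fromRows_tangent_transpose_mul (hΩ.symm_eq u hv) (hdet u hv) hA)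
  · intro k b u hv
    let D : Matrix (Fin n) (Fin m) ℝ := Matrix.of fun l a => if l = k then H a k u else 0
    have hGD : pdMat k (matG s) u = frameMatrix X u * D := by
      ext i a
      change pd k (fun v => s a v i) u = _
      rw [(hs a).eq i k u hv]
      simp [Matrix.mul_apply, D]
    have hRD : pdMat k (fun v => (Ω v)⁻¹) u =
        -((Ω u)⁻¹ * ((matG s u)ᵀ * frameMatrix X u) * (D * (Ω u)⁻¹)) := by
      rw [pdMat_inv hU hΩ.smooth hu hv, hΩ.deriv_eq k u hv, hGD]
      simp only [Matrix.mul_assoc]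
    have hup : pdMat k (fun v => matG s v * (Ω v)⁻¹) u =
        (frameMatrix X u - matG s u * ((Ω u)⁻¹ * ((matG s u)ᵀ * frameMatrix X u))) *
          (D * (Ω u)⁻¹) := by
      rw [pdMat_mul (fun i a => diffAt hU (hG i a) hv) (fun a b => diffAt hU (hR a b) hv), hRD, hGD]
      simp only [Matrix.sub_mul, Matrix.mul_neg, Matrix.mul_assoc]
      rw [sub_eq_add_neg]
    have hlow : pdMat k (fun v => 1 - (Ω v)⁻¹) u =
        ((Ω u)⁻¹ * ((matG s u)ᵀ * frameMatrix X u)) * (D * (Ω u)⁻¹) := by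
      rw [pdMat_sub (A := fun _ => 1) (fun a b => differentiableAt_const _)
          (fun a b => diffAt hU (hR a b) hv),
        pdMat_const, hRD, zero_sub, neg_neg]
    have hD : ∀ l, (D * (Ω u)⁻¹) l b = if l = k then ∑ c, H c k u * (Ω u)⁻¹ c b else 0 := by
      intro l
      by_cases hl : l = k <;> simp [Matrix.mul_apply, D, hl]
    ext r
    rw [← pd_coord (diffAt hU (hsm b) hv)]
    rcases r with i | c
    · change pdMat k (fun v => matG s v * (Ω v)⁻¹) u i b = _
      rw [hup, Matrix.mul_apply]
      simp only [hD]
      simp [colVec, mul_comm]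
    · change pdMat k (fun v => 1 - (Ω v)⁻¹) u c b = _
      rw [hlow, Matrix.mul_apply]
      simp only [hD]
      simp [colVec, mul_comm]

end ParallelFrame

/-! ### Normal spaces, and the geometry of the columns of a parallel frame -/

section NormalSpace

variable {n : ℕ} {F : Type*} [NormedAddCommGroup F] [InnerProductSpace ℝ F]
  {g : Eu n → F} {u : Eu n}

lemma mem_normalSpace_iff {v : F} :
    v ∈ normalSpace g u ↔ inner ℝ (g u) v = 0 ∧ ∀ k, inner ℝ (pd k g u) v = 0 := by
  rw [normalSpace, ← Submodule.inf_orthogonal, Submodule.mem_inf,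
    Submodule.mem_orthogonal_singleton_iff_inner_right, Submodule.mem_orthogonal]
  refine and_congr_right fun _ => ⟨fun h k => h _ ⟨_, rfl⟩, ?_⟩
  rintro h _ ⟨x, rfl⟩
  change inner ℝ (fderiv ℝ g u x) v = 0
  simp [fderiv_apply_eq_sum, sum_inner, inner_smul_left, h]

lemma normalProj_eq_of_mem [FiniteDimensional ℝ F] {v w : F} (hw : w ∈ normalSpace g u)
    (h : ∀ z ∈ normalSpace g u, inner ℝ (v - w) z = 0) : normalProj g u v = w := by
  rw [normalProj]
  exact Submodule.eq_starProjection_of_mem_of_inner_eq_zero hw h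

lemma pd_ne_zero (h : Function.Injective (fderiv ℝ g u)) (k : Fin n) : pd k g u ≠ 0 := by
  intro h0
  have : (EuclideanSpace.single k (1 : ℝ) : Eu n) = 0 := h (by rw [map_zero]; exact h0)
  simp at this

lemma isOpen_regularSet {U : Set (Eu n)} (hU : IsOpen U) (hg : ContDiffOn ℝ ∞ g U) :
    IsOpen (regularSet g U) :=
  (contDiffOn_fderiv hU hg).continuousOn.isOpen_inter_preimage hU
    ContinuousLinearMap.isOpen_injective

lemma sum_inner_smul_eq {ι : Type*} [Fintype ι] [FiniteDimensional ℝ F] {e : ι → F}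
    (he : Orthonormal ℝ e) (hcard : Fintype.card ι = Module.finrank ℝ F) (v : F) :
    ∑ i, inner ℝ (e i) v • e i = v := by
  classical
  rcases isEmpty_or_nonempty ι with hι | hι
  · have : Module.finrank ℝ F = 0 := by rw [← hcard]; exact Fintype.card_eq_zero
    have := Module.finrank_zero_iff.1 this
    exact Subsingleton.elim _ _
  have hb : ⊤ ≤ Submodule.span ℝ (Set.range e) :=
    (he.linearIndependent.span_eq_top_of_card_eq_finrank hcard).ge
  have := (OrthonormalBasis.mk he hb).sum_repr' v
  simpa using this

end NormalSpace

namespace IsParallelFrame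

variable {n m : ℕ} {U : Set (Eu n)} {W : Fin m → Eu n → Amb n m} {ξ : Fin n → Eu n → Amb n m}
  {V : Fin n → Fin m → Eu n → ℝ}

section

variable (h : IsParallelFrame U W ξ V) {u : Eu n} (hu : u ∈ U)
include h hu

lemma inner_normal (a b : Fin m) : inner ℝ (W a u) (W b u) = if a = b then 1 else 0 := by
  have := orthonormal_iff_ite.1 (h.orthonormal u hu) (Sum.inr a) (Sum.inr b)
  simpa using this

lemma inner_tangent (k l : Fin n) : inner ℝ (ξ k u) (ξ l u) = if k = l then 1 else 0 := by
  have := orthonormal_iff_ite.1 (h.orthonormal u hu) (Sum.inl k) (Sum.inl l)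
  simpa using this

lemma inner_tangent_normal (k : Fin n) (b : Fin m) : inner ℝ (ξ k u) (W b u) = 0 := by
  have := orthonormal_iff_ite.1 (h.orthonormal u hu) (Sum.inl k) (Sum.inr b)
  simpa using this

lemma expand (v : Amb n m) :
    ∑ k, inner ℝ (ξ k u) v • ξ k u + ∑ b, inner ℝ (W b u) v • W b u = v := by
  have := sum_inner_smul_eq (h.orthonormal u hu) (by simp) v
  rwa [Fintype.sum_sum_type] at this

end

variable (h : IsParallelFrame U W ξ V) {u : Eu n} (hu : u ∈ U) {a : Fin m}
include h hu

lemma coeff_ne_zero (hinj : Function.Injective (fderiv ℝ (W a) u)) (k : Fin n) :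
    V k a u ≠ 0 := by
  intro h0
  apply pd_ne_zero hinj k
  rw [h.pd_eq k a u hu, h0, zero_smul]

/-- At a regular point of `W_a` the normal space is the orthogonal complement of `W_a` and of all
the `ξ_k`. -/
lemma mem_normalSpace_iff (hinj : Function.Injective (fderiv ℝ (W a) u)) {v : Amb n m} :
    v ∈ normalSpace (W a) u ↔ inner ℝ (W a u) v = 0 ∧ ∀ k, inner ℝ (ξ k u) v = 0 := by
  rw [Ferapontov.mem_normalSpace_iff]
  refine and_congr_right fun _ => forall_congr' fun k => ?_
  rw [h.pd_eq k a u hu, inner_smul_left]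
  simp [h.coeff_ne_zero hu hinj k]

lemma eq_sum_of_mem_normalSpace (hinj : Function.Injective (fderiv ℝ (W a) u)) {v : Amb n m}
    (hv : v ∈ normalSpace (W a) u) :
    v = ∑ b ∈ Finset.univ.erase a, inner ℝ (W b u) v • W b u := by
  rw [h.mem_normalSpace_iff hu hinj] at hv
  conv_lhs => rw [← h.expand hu v]
  rw [← Finset.add_sum_erase _ _ (Finset.mem_univ a)]
  simp [hv.1, hv.2]

lemma sum_mem_normalSpace (hinj : Function.Injective (fderiv ℝ (W a) u)) (c : Fin m → ℝ) :
    ∑ b ∈ Finset.univ.erase a, c b • W b u ∈ normalSpace (W a) u := by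
  refine Submodule.sum_mem _ fun b hb => Submodule.smul_mem _ _ ?_
  rw [h.mem_normalSpace_iff hu hinj, h.inner_normal hu, if_neg (Finset.ne_of_mem_erase hb).symm]
  exact ⟨rfl, fun k => h.inner_tangent_normal hu k b⟩

/-- The `W_b`, `b ≠ a`, are parallel in the normal connection of `W_a`. -/
lemma normalProj_pd_sum (hU : IsOpen U) (hinj : Function.Injective (fderiv ℝ (W a) u))
    {c : Fin m → Eu n → ℝ} (hc : ∀ b, DifferentiableAt ℝ (c b) u) (k : Fin n) :
    normalProj (W a) u (pd k (fun v => ∑ b ∈ Finset.univ.erase a, c b v • W b v) u) =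
      ∑ b ∈ Finset.univ.erase a, pd k (c b) u • W b u := by
  have hd : ∀ b, DifferentiableAt ℝ (W b) u := fun b => diffAt hU (h.smooth b) hu
  refine normalProj_eq_of_mem (h.sum_mem_normalSpace hu hinj _) fun z hz => ?_
  rw [h.mem_normalSpace_iff hu hinj] at hz
  rw [pd_sum _ fun b _ => (hc b).fun_smul (hd b), ← Finset.sum_sub_distrib, sum_inner]
  refine Finset.sum_eq_zero fun b _ => ?_
  rw [pd_smul (hc b) (hd b), add_sub_cancel_right, h.pd_eq k b u hu, inner_smul_left,
    inner_smul_left, hz.2 k, mul_zero, mul_zero]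

omit hu in
/-- Normal fields of `W_a` are combinations of the parallel fields `W_b`, and on their coefficients
the normal connection acts by partial derivatives, which commute. -/
theorem hasFlatNormalBundle (hU : IsOpen U) :
    HasFlatNormalBundle (W a) (regularSet (W a) U) := by
  intro O hO hOV η hη hn j k u hu
  have hOU : ∀ v ∈ O, v ∈ U := fun v hv => (hOV hv).1
  have hinj : ∀ v ∈ O, Function.Injective (fderiv ℝ (W a) v) := fun v hv => (hOV hv).2
  let c : Fin m → Eu n → ℝ := fun b v => inner ℝ (W b v) (η v)
  have hc : ∀ b, ContDiffOn ℝ ∞ (c b) O := fun b => ((h.smooth b).mono hOU).inner ℝ hη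
  have hfield : ∀ v ∈ O, η v = ∑ b ∈ Finset.univ.erase a, c b v • W b v := fun v hv =>
    h.eq_sum_of_mem_normalSpace (hOU v hv) (hinj v hv) (hn v hv)
  have hD : ∀ k, ∀ v ∈ O, normalD (W a) k η v =
      ∑ b ∈ Finset.univ.erase a, pd k (c b) v • W b v := by
    intro k v hv
    rw [normalD, pd_congr_on hO hv hfield,
      h.normalProj_pd_sum (hOU v hv) hU (hinj v hv) fun b => diffAt hO (hc b) hv]
  have hDD : ∀ j k, ∀ v ∈ O, normalD (W a) j (normalD (W a) k η) v =
      ∑ b ∈ Finset.univ.erase a, pd j (pd k (c b)) v • W b v := by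
    intro j k v hv
    rw [normalD, pd_congr_on hO hv (hD k),
      h.normalProj_pd_sum (hOU v hv) hU (hinj v hv) fun b =>
        diffAt hO (contDiffOn_pd hO (hc b) k) hv]
  rw [hDD j k u hu, hDD k j u hu]
  exact Finset.sum_congr rfl fun b _ => by rw [pd_comm hO (hc b) hu]

omit hu in
theorem hasPrincipalCoordinates (hU : IsOpen U) :
    HasPrincipalCoordinates (W a) (regularSet (W a) U) := by
  rintro u ⟨hu, hinj⟩ i j hij
  have hd : ∀ b, DifferentiableAt ℝ (W b) u := fun b => diffAt hU (h.smooth b) hu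
  constructor
  · rw [h.pd_eq i a u hu, h.pd_eq j a u hu, inner_smul_left, inner_smul_right,
      h.inner_tangent hu, if_neg hij, mul_zero, mul_zero]
  · have hd' := diffAt hU (contDiffOn_pd hU (h.smooth a) j) hu
    have hW : ∀ b, inner ℝ (W b u) (pd i (pd j (W a)) u) = 0 := by
      intro b
      have h0 : ∀ v ∈ U, inner ℝ (W b v) (pd j (W a) v) = (0 : ℝ) := by
        intro v hv
        rw [h.pd_eq j a v hv, inner_smul_right, real_inner_comm, h.inner_tangent_normal hv,
          mul_zero]
      have h1 := pd_congr_on hU hu h0 i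
      rw [pd_inner (hd b) hd', pd_const, h.pd_eq i b u hu, h.pd_eq j a u hu, inner_smul_left,
        inner_smul_right, h.inner_tangent hu, if_neg hij] at h1
      simpa using h1
    refine normalProj_eq_of_mem (Submodule.zero_mem _) fun z hz => ?_
    rw [h.mem_normalSpace_iff hu hinj] at hz
    rw [sub_zero, ← h.expand hu (pd i (pd j (W a)) u)]
    simp [sum_inner, inner_smul_left, hW, hz.2]

omit hu in
theorem isSphericalImmersion (hU : IsOpen U) :
    IsSphericalImmersion (W a) (regularSet (W a) U) where
  isOpen := isOpen_regularSet hU (h.smooth a)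
  smooth := (h.smooth a).mono fun _ hu => hu.1
  mem_sphere u hu := by
    simpa using (h.orthonormal u hu.1).1 (Sum.inr a)
  injective _ hu := hu.2

end IsParallelFrame

/-! ### Parallel transport for a family of projections -/

section Transport

open Set

variable {E F : Type*} [NormedAddCommGroup E] [NormedSpace ℝ E] [NormedAddCommGroup F]
  [NormedSpace ℝ F]

lemma hasDerivWithinAt_Ici_of_Icc {y : ℝ → F} {y' : F} {t : ℝ} (ht : t ∈ Ico (0 : ℝ) 1)
    (h : HasDerivWithinAt y y' (Icc 0 1) t) : HasDerivWithinAt y y' (Ici t) t :=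
  h.mono_of_mem_nhdsWithin (Icc_mem_nhdsGE_of_mem ht)

lemma hasDerivAt_comp_ray {f : E → F} {f' : E →L[ℝ] F} {x₀ v : E} {t : ℝ}
    (h : HasFDerivAt f f' (x₀ + t • v)) : HasDerivAt (fun t : ℝ => f (x₀ + t • v)) (f' v) t := by
  have h1 : HasDerivAt (fun t : ℝ => x₀ + t • v) v t := by
    simpa using ((hasDerivAt_id t).smul_const v).const_add x₀
  exact h.comp_hasDerivAt t h1

/-- Solutions of the transport equation along a short ray. -/
lemma exists_transport_ray [CompleteSpace F] {A : E → E →L[ℝ] F →L[ℝ] F} {x₀ v : E} {M : ℝ}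
    (hA : ∀ t ∈ Icc (0 : ℝ) 1, ContinuousAt A (x₀ + t • v))
    (hM : ∀ t ∈ Icc (0 : ℝ) 1, ‖A (x₀ + t • v)‖ ≤ M) (hv : M * ‖v‖ ≤ 1 / 2) (y₀ : F) :
    ∃ y : ℝ → F, y 0 = y₀ ∧
      ∀ t ∈ Icc (0 : ℝ) 1, HasDerivWithinAt y (A (x₀ + t • v) v (y t)) (Icc 0 1) t := by
  have hM0 : 0 ≤ M := le_trans (norm_nonneg (A (x₀ + (0 : ℝ) • v))) (hM 0 (by simp))
  have hop : ∀ t ∈ Icc (0 : ℝ) 1, ‖A (x₀ + t • v) v‖ ≤ 1 / 2 := fun t ht =>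
    ((A (x₀ + t • v)).le_opNorm v).trans
      ((mul_le_mul_of_nonneg_right (hM t ht) (norm_nonneg v)).trans hv)
  let K : NNReal := ⟨1 / 2, by norm_num⟩
  let a : NNReal := ⟨‖y₀‖, norm_nonneg _⟩
  have hPL : IsPicardLindelof (fun t y => A (x₀ + t • v) v y)
      (⟨0, by simp⟩ : Icc (0 : ℝ) 1) y₀ a 0 a K := by
    constructor
    · intro t ht
      refine LipschitzWith.lipschitzOnWith (LipschitzWith.weaken (A (x₀ + t • v) v).lipschitz ?_)
      exact NNReal.coe_le_coe.1 (hop t ht)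
    · intro x _ t ht
      have h1 : ContinuousAt (fun t : ℝ => A (x₀ + t • v)) t :=
        ContinuousAt.comp (f := fun t : ℝ => x₀ + t • v) (hA t ht) (by fun_prop)
      exact ((h1.clm_apply continuousAt_const).clm_apply continuousAt_const).continuousWithinAt
    · intro t ht x hx
      have h1 : ‖x‖ ≤ 2 * ‖y₀‖ := by
        have h2 : ‖x - y₀‖ ≤ ‖y₀‖ := mem_closedBall_iff_norm.1 hx
        have h3 := norm_le_norm_add_norm_sub' x y₀
        linarith
      calc ‖A (x₀ + t • v) v x‖ ≤ 1 / 2 * ‖x‖ :=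
            ((A (x₀ + t • v) v).le_opNorm x).trans
              (mul_le_mul_of_nonneg_right (hop t ht) (norm_nonneg x))
        _ ≤ ‖y₀‖ := by linarith
    · simp
  exact hPL.exists_eq_forall_mem_Icc_hasDerivWithinAt₀

/-- Transport by the derivative of a family of projections preserves the ranges of the
projections. -/
lemma transport_mem_range {P : E → F →L[ℝ] F} {x₀ v : E} {C : ℝ} {y : ℝ → F}
    (hP : ∀ t ∈ Icc (0 : ℝ) 1, DifferentiableAt ℝ P (x₀ + t • v))
    (hC : ∀ t ∈ Icc (0 : ℝ) 1, ‖P (x₀ + t • v)‖ * ‖fderiv ℝ P (x₀ + t • v) v‖ ≤ C)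
    (hPP : ∀ t ∈ Icc (0 : ℝ) 1, ∀ w z,
      P (x₀ + t • v) (fderiv ℝ P (x₀ + t • v) w (P (x₀ + t • v) z)) = 0)
    (hy : ∀ t ∈ Icc (0 : ℝ) 1,
      HasDerivWithinAt y (fderiv ℝ P (x₀ + t • v) v (y t)) (Icc 0 1) t)
    (h0 : P x₀ (y 0) = y 0) : ∀ t ∈ Icc (0 : ℝ) 1, P (x₀ + t • v) (y t) = y t := by
  have hq : ∀ t ∈ Icc (0 : ℝ) 1, HasDerivWithinAt (fun t => y t - P (x₀ + t • v) (y t))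
      (-(P (x₀ + t • v) (fderiv ℝ P (x₀ + t • v) v (y t - P (x₀ + t • v) (y t)))))
      (Icc 0 1) t := by
    intro t ht
    have h2 := (hasDerivAt_comp_ray (hP t ht).hasFDerivAt).hasDerivWithinAt (s := Icc (0 : ℝ) 1)
    have h3 := (hy t ht).fun_sub (h2.clm_apply (hy t ht))
    refine h3.congr_deriv ?_
    rw [map_sub, map_sub, hPP t ht]
    simp
  have h := eq_zero_of_abs_deriv_le_mul_abs_self_of_eq_zero_right
    (f := fun t => y t - P (x₀ + t • v) (y t)) (K := C)
    (fun t ht => (hq t ht).continuousWithinAt)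
    (fun t ht => hasDerivWithinAt_Ici_of_Icc ht (hq t (Ico_subset_Icc_self ht)))
    (by simp [h0]) (fun t ht => by
      rw [norm_neg]
      have ht' := Ico_subset_Icc_self ht
      refine ((P (x₀ + t • v)).le_opNorm _).trans ?_
      refine le_trans (mul_le_mul_of_nonneg_left (ContinuousLinearMap.le_opNorm _ _)
        (norm_nonneg _)) ?_
      rw [← mul_assoc]
      exact mul_le_mul_of_nonneg_right (hC t ht') (norm_nonneg _))
  intro t ht
  exact (sub_eq_zero.1 (h t ht)).symm

/-- Comparison of the transports along two rays with initial velocities `v` and `v + h`. By the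
symmetry of `A'` and the commutation relation, `t A(x₀ + tv) h (y t)` solves the linearised
equation, so that the error satisfies a Gronwall inequality with a quadratic inhomogeneity. -/
lemma transport_compare {A : E → E →L[ℝ] F →L[ℝ] F} {A' : E → E →L[ℝ] E →L[ℝ] F →L[ℝ] F}
    {B : Set E} {x₀ v h : E} {M C : ℝ} {y y₂ : ℝ → F} (hM1 : 1 ≤ M)
    (hA : ∀ x ∈ B, HasFDerivAt A (A' x) x) (hsymm : ∀ x ∈ B, ∀ w z, A' x w z = A' x z w)
    (hAM : ∀ x ∈ B, ‖A x‖ ≤ M) (hLip : ∀ x ∈ B, ∀ z ∈ B, ‖A x - A z‖ ≤ M * ‖x - z‖)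
    (hTay : ∀ x ∈ B, ∀ z ∈ B, ‖A x - A z - A' z (x - z)‖ ≤ M * ‖x - z‖ ^ 2)
    (hv : ‖v‖ ≤ 1) (hvh : ‖v + h‖ ≤ 1) (hB : ∀ t ∈ Icc (0 : ℝ) 1, x₀ + t • v ∈ B)
    (hB₂ : ∀ t ∈ Icc (0 : ℝ) 1, x₀ + t • (v + h) ∈ B)
    (hy : ∀ t ∈ Icc (0 : ℝ) 1, HasDerivWithinAt y (A (x₀ + t • v) v (y t)) (Icc 0 1) t)
    (hy₂ : ∀ t ∈ Icc (0 : ℝ) 1,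
      HasDerivWithinAt y₂ (A (x₀ + t • (v + h)) (v + h) (y₂ t)) (Icc 0 1) t)
    (h0 : y₂ 0 = y 0) (hC : ∀ t ∈ Icc (0 : ℝ) 1, ‖y t‖ ≤ C)
    (hcomm : ∀ t ∈ Icc (0 : ℝ) 1, ∀ w z,
      A (x₀ + t • v) w (A (x₀ + t • v) z (y t)) = A (x₀ + t • v) z (A (x₀ + t • v) w (y t))) :
    ‖y₂ 1 - y 1 - A (x₀ + v) h (y 1)‖ ≤
      (2 * M * C + 2 * M * (M * C)) / M * (Real.exp M - 1) * ‖h‖ ^ 2 := by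
  have hC0 : 0 ≤ C := (norm_nonneg _).trans (hC 0 (by simp))
  have hM0 : 0 ≤ M := by linarith
  set r : ℝ → F := fun t => y₂ t - y t - t • A (x₀ + t • v) h (y t) with hr
  set ε : ℝ := (2 * M * C + 2 * M * (M * C)) * ‖h‖ ^ 2 with hε
  let r' : ℝ → F := fun t => A (x₀ + t • (v + h)) (v + h) (y₂ t) - A (x₀ + t • v) v (y t) -
    (t • (A' (x₀ + t • v) v h (y t) + A (x₀ + t • v) h (A (x₀ + t • v) v (y t))) +
      A (x₀ + t • v) h (y t))
  have hder : ∀ t ∈ Icc (0 : ℝ) 1, HasDerivWithinAt r (r' t) (Icc 0 1) t := by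
    intro t ht
    have h2 := hasDerivAt_comp_ray (F := E →L[ℝ] F →L[ℝ] F) (hA _ (hB t ht))
    have h3 : HasDerivAt (fun t : ℝ => A (x₀ + t • v) h) (A' (x₀ + t • v) v h) t := by
      simpa using h2.clm_apply (hasDerivAt_const t h)
    have h4 := (h3.hasDerivWithinAt (s := Icc (0 : ℝ) 1)).clm_apply (hy t ht)
    have h5 := ((hasDerivWithinAt_id t (Icc (0 : ℝ) 1)).smul h4)
    have h6 := ((hy₂ t ht).sub (hy t ht)).sub h5
    refine h6.congr_deriv ?_
    simp [r']
  have hbound : ∀ t ∈ Ico (0 : ℝ) 1, ‖r' t‖ ≤ M * ‖r t‖ + ε := by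
    intro t ht'
    have ht := Ico_subset_Icc_self ht'
    set p := x₀ + t • v with hp
    set q := x₀ + t • (v + h) with hq
    have hqp : q - p = t • h := by rw [hq, hp]; module
    have hth : ‖q - p‖ ≤ ‖h‖ := by
      rw [hqp, norm_smul, Real.norm_of_nonneg ht.1]
      exact mul_le_of_le_one_left (norm_nonneg h) ht.2
    have hpB := hB t ht
    have hqB := hB₂ t ht
    set z := t • A p h (y t) with hz
    have hsplit : r' t = A q (v + h) (r t) +
        ((A q - A p - A' p (q - p)) v (y t) + (A q - A p) h (y t)) +
        ((A q - A p) (v + h) z + A p h z) := by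
      have e1 : A p v z = t • A p h (A p v (y t)) := by
        rw [hz, map_smul, hcomm t ht v h]
      have e2 : A' p (q - p) v (y t) = t • A' p v h (y t) := by
        rw [hqp, map_smul, hsymm p hpB v h]
        rfl
      have e3 : y₂ t = r t + y t + z := by simp only [hr, hz]; abel
      simp only [r', ← hp, ← hq]
      rw [e3]
      simp only [map_add, sub_apply, add_apply, smul_add, e2]
      rw [← e1]
      abel
    have hn1 : ‖A q (v + h) (r t)‖ ≤ M * ‖r t‖ :=
      ContinuousLinearMap.le_of_opNorm_le _
        (((A q).le_opNorm_of_le hvh).trans (by simpa using hAM q hqB)) _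
    have hn2 : ‖(A q - A p - A' p (q - p)) v (y t)‖ ≤ M * ‖h‖ ^ 2 * C := by
      have h1 : ‖(A q - A p - A' p (q - p)) v‖ ≤ M * ‖h‖ ^ 2 := by
        refine ((A q - A p - A' p (q - p)).le_opNorm_of_le hv).trans ?_
        rw [mul_one]
        exact (hTay q hqB p hpB).trans (by gcongr)
      exact (ContinuousLinearMap.le_of_opNorm_le _ h1 _).trans (by gcongr; exact hC t ht)
    have hLq : ‖A q - A p‖ ≤ M * ‖h‖ := (hLip q hqB p hpB).trans (by gcongr)
    have hn3 : ‖(A q - A p) h (y t)‖ ≤ M * ‖h‖ * ‖h‖ * C :=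
      (ContinuousLinearMap.le_of_opNorm_le _ (ContinuousLinearMap.le_of_opNorm_le _ hLq h) _).trans
        (by gcongr; exact hC t ht)
    have hAh : ‖A p h‖ ≤ M * ‖h‖ := ContinuousLinearMap.le_of_opNorm_le _ (hAM p hpB) h
    have hzn : ‖z‖ ≤ M * ‖h‖ * C := by
      rw [hz, norm_smul, Real.norm_of_nonneg ht.1]
      refine (mul_le_of_le_one_left (norm_nonneg _) ht.2).trans ?_
      exact (ContinuousLinearMap.le_of_opNorm_le _ hAh _).trans (by gcongr; exact hC t ht)
    have hn4 : ‖(A q - A p) (v + h) z‖ ≤ M * ‖h‖ * (M * ‖h‖ * C) := by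
      have h1 : ‖(A q - A p) (v + h)‖ ≤ M * ‖h‖ := by
        simpa using ((A q - A p).le_opNorm_of_le hvh).trans (by simpa using hLq)
      exact (ContinuousLinearMap.le_of_opNorm_le _ h1 _).trans (by gcongr)
    have hn5 : ‖A p h z‖ ≤ M * ‖h‖ * (M * ‖h‖ * C) :=
      (ContinuousLinearMap.le_of_opNorm_le _ hAh _).trans (by gcongr)
    rw [hsplit]
    refine (norm_add₃_le).trans ?_
    have := norm_add_le ((A q - A p - A' p (q - p)) v (y t)) ((A q - A p) h (y t))
    have := norm_add_le ((A q - A p) (v + h) z) (A p h z)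
    rw [hε]
    nlinarith
  have hg := norm_le_gronwallBound_of_norm_deriv_right_le (f := r) (δ := 0)
    (fun t ht => (hder t ht).continuousWithinAt)
    (fun t ht => hasDerivWithinAt_Ici_of_Icc ht (hder t (Ico_subset_Icc_self ht)))
    (by simp [hr, h0]) hbound 1 (by simp)
  rw [gronwallBound_of_K_ne_0 (by linarith)] at hg
  simp only [hr, one_smul, sub_zero, zero_mul, zero_add, mul_one] at hg
  refine hg.trans (le_of_eq ?_)
  rw [hε]
  ring

end Transport

section Transport

open Set

variable {E F : Type*} [NormedAddCommGroup E] [NormedSpace ℝ E] [NormedAddCommGroup F]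
  [NormedSpace ℝ F]

/-- The second order Taylor estimate with a constant that is uniform near a point. -/
lemma exists_taylor_bound {U : Set E} (hU : IsOpen U) {A : E → F} (hA : ContDiffOn ℝ ∞ A U)
    {x₀ : E} (hx₀ : x₀ ∈ U) : ∃ M > 0, ∃ ρ > 0, Metric.ball x₀ ρ ⊆ U ∧
      (∀ x ∈ Metric.ball x₀ ρ, ‖A x‖ ≤ M) ∧
      (∀ x ∈ Metric.ball x₀ ρ, ∀ z ∈ Metric.ball x₀ ρ, ‖A x - A z‖ ≤ M * ‖x - z‖) ∧
      (∀ x ∈ Metric.ball x₀ ρ, ∀ z ∈ Metric.ball x₀ ρ,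
        ‖A x - A z - fderiv ℝ A z (x - z)‖ ≤ M * ‖x - z‖ ^ 2) := by
  have hA' : ContDiffOn ℝ ∞ (fderiv ℝ A) U := hA.fderiv_of_isOpen hU (by simp)
  have hnhds := hU.mem_nhds hx₀
  obtain ⟨K, s, hs, hK⟩ := ((hA'.contDiffAt hnhds).of_le
    (by simp : (1 : WithTop ℕ∞) ≤ ∞)).exists_lipschitzOnWith
  have h1 : ∀ᶠ x in nhds x₀, ‖A x‖ < ‖A x₀‖ + 1 :=
    (hA.contDiffAt hnhds).continuousAt.norm.eventually (gt_mem_nhds (lt_add_one _))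
  have h2 : ∀ᶠ x in nhds x₀, ‖fderiv ℝ A x‖ < ‖fderiv ℝ A x₀‖ + 1 :=
    (hA'.contDiffAt hnhds).continuousAt.norm.eventually (gt_mem_nhds (lt_add_one _))
  obtain ⟨ρ, hρ, hball⟩ := Metric.eventually_nhds_iff_ball.1
    (h1.and (h2.and ((Filter.eventually_mem_set.2 hs).and (hU.eventually_mem hx₀))))
  have hd : ∀ x ∈ Metric.ball x₀ ρ, HasFDerivAt A (fderiv ℝ A x) x := fun x hx =>
    ((hA.contDiffAt (hU.mem_nhds (hball x hx).2.2.2)).differentiableAt (by simp)).hasFDerivAt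
  let M : ℝ := ‖A x₀‖ + 1 + (‖fderiv ℝ A x₀‖ + 1) + K
  have hM1 : ‖A x₀‖ + 1 ≤ M := by
    have := norm_nonneg (fderiv ℝ A x₀)
    have := K.coe_nonneg
    simp only [M]; linarith
  have hM2 : ‖fderiv ℝ A x₀‖ + 1 ≤ M := by
    have := norm_nonneg (A x₀)
    have := K.coe_nonneg
    simp only [M]; linarith
  have hM3 : (K : ℝ) ≤ M := by
    have := norm_nonneg (A x₀)
    have := norm_nonneg (fderiv ℝ A x₀)
    simp only [M]; linarith
  refine ⟨M, lt_of_lt_of_le (by positivity) hM1, ρ, hρ, fun x hx => (hball x hx).2.2.2,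
    fun x hx => ((hball x hx).1.le.trans hM1), ?_, ?_⟩
  · intro x hx z hz
    exact (convex_ball x₀ ρ).norm_image_sub_le_of_norm_hasFDerivWithin_le
      (fun w hw => (hd w hw).hasFDerivWithinAt) (fun w hw => (hball w hw).2.1.le.trans hM2) hz hx
  · intro x hx z hz
    have hconv : Convex ℝ (Metric.ball x₀ ρ ∩ Metric.closedBall z ‖x - z‖) :=
      (convex_ball _ _).inter (convex_closedBall _ _)
    have := hconv.norm_image_sub_le_of_norm_hasFDerivWithin_le' (C := M * ‖x - z‖)
      (φ := fderiv ℝ A z) (fun w hw => (hd w hw.1).hasFDerivWithinAt)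
      (fun w hw => by
        refine (hK.norm_sub_le (hball w hw.1).2.2.1 (hball z hz).2.2.1).trans ?_
        exact mul_le_mul hM3 (mem_closedBall_iff_norm.1 hw.2) (norm_nonneg _)
          (K.coe_nonneg.trans hM3))
      (x := z) (y := x) ⟨hz, by simp⟩ ⟨hx, by simp [dist_eq_norm]⟩
    rwa [mul_assoc, ← sq] at this

/-- Local existence of parallel sections: if `P` is a smooth family of projections whose
derivatives commute on the ranges, every vector of the range of `P x₀` extends to a section `c`
of the ranges with `dc = (dP) c`. -/
theorem exists_parallel_section [CompleteSpace F] {U : Set E} (hU : IsOpen U) {P : E → F →L[ℝ] F}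
    (hP : ContDiffOn ℝ ∞ P U) (hproj : ∀ x ∈ U, ∀ z, P x (P x z) = P x z)
    (hcomm : ∀ x ∈ U, ∀ y, P x y = y → ∀ w z,
      fderiv ℝ P x w (fderiv ℝ P x z y) = fderiv ℝ P x z (fderiv ℝ P x w y))
    {x₀ : E} (hx₀ : x₀ ∈ U) : ∃ r > 0, Metric.ball x₀ r ⊆ U ∧ ∀ y₀, P x₀ y₀ = y₀ →
      ∃ c : E → F, c x₀ = y₀ ∧ ∀ x ∈ Metric.ball x₀ r,
        P x (c x) = c x ∧ HasFDerivAt c ((fderiv ℝ P x).flip (c x)) x := by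
  have hA : ContDiffOn ℝ ∞ (fderiv ℝ P) U := hP.fderiv_of_isOpen hU (by simp)
  have hPd : ∀ x ∈ U, DifferentiableAt ℝ P x := fun x hx =>
    (hP.contDiffAt (hU.mem_nhds hx)).differentiableAt (by simp)
  have hAd : ∀ x ∈ U, DifferentiableAt ℝ (fderiv ℝ P) x := fun x hx =>
    (hA.contDiffAt (hU.mem_nhds hx)).differentiableAt (by simp)
  have hPP : ∀ x ∈ U, ∀ w z, P x (fderiv ℝ P x w (P x z)) = 0 := by
    intro x hx w z
    have h1 := (hPd x hx).hasFDerivAt.clm_apply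
      ((hPd x hx).hasFDerivAt.clm_apply (hasFDerivAt_const (P x z) x))
    have h2 := (hPd x hx).hasFDerivAt.clm_apply (hasFDerivAt_const (P x z) x)
    have h3 : (fun v => P v (P v (P x z))) =ᶠ[nhds x] fun v => P v (P x z) :=
      Filter.eventuallyEq_of_mem (hU.mem_nhds hx) fun v hv => hproj v hv _
    have h4 := congrArg (fun L : E →L[ℝ] F => L w) ((h2.congr_of_eventuallyEq h3).unique h1)
    simp [hproj x hx] at h4
    exact h4
  obtain ⟨M₁, hM₁, ρ₁, hρ₁, hb₁, hPM, -, -⟩ := exists_taylor_bound hU hP hx₀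
  obtain ⟨M₂, hM₂, ρ₂, hρ₂, hb₂, hAM, hLip, hTay⟩ :=
    exists_taylor_bound (F := E →L[ℝ] F →L[ℝ] F) hU hA hx₀
  set M := M₂ + 1 with hM
  have hMpos : 0 < M := by positivity
  have hM2 : M₂ ≤ M := by linarith
  set r := min (min ρ₁ ρ₂) (1 / (2 * M)) with hr
  have hr1 : r ≤ ρ₁ := (min_le_left _ _).trans (min_le_left _ _)
  have hr2 : r ≤ ρ₂ := (min_le_left _ _).trans (min_le_right _ _)
  have hr3 : r ≤ 1 / (2 * M) := min_le_right _ _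
  have hrpos : 0 < r := lt_min (lt_min hρ₁ hρ₂) (by positivity)
  have hMr : M * r ≤ 1 / 2 := by
    calc M * r ≤ M * (1 / (2 * M)) := by gcongr
      _ = 1 / 2 := by field_simp
  have hr4 : r ≤ 1 := by nlinarith
  have hBU : Metric.ball x₀ r ⊆ U := (Metric.ball_subset_ball hr1).trans hb₁
  have hB2 : Metric.ball x₀ r ⊆ Metric.ball x₀ ρ₂ := Metric.ball_subset_ball hr2
  have hray : ∀ v, ‖v‖ < r → ∀ t ∈ Icc (0 : ℝ) 1, x₀ + t • v ∈ Metric.ball x₀ r := by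
    intro v hv t ht
    rw [mem_ball_iff_norm, add_sub_cancel_left, norm_smul, Real.norm_of_nonneg ht.1]
    exact (mul_le_of_le_one_left (norm_nonneg v) ht.2).trans_lt hv
  refine ⟨r, hrpos, hBU, fun y₀ hy₀ => ?_⟩
  have hex : ∀ v, ∃ y : ℝ → F, ‖v‖ < r → y 0 = y₀ ∧ ∀ t ∈ Icc (0 : ℝ) 1,
      HasDerivWithinAt y (fderiv ℝ P (x₀ + t • v) v (y t)) (Icc 0 1) t := by
    intro v
    by_cases hv : ‖v‖ < r
    · obtain ⟨y, hy⟩ := exists_transport_ray (A := fderiv ℝ P) (x₀ := x₀) (v := v) (M := M)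
        (fun t ht => (hAd _ (hBU (hray v hv t ht))).continuousAt)
        (fun t ht => (hAM _ (hB2 (hray v hv t ht))).trans hM2)
        ((mul_le_mul_of_nonneg_left hv.le hMpos.le).trans hMr) y₀
      exact ⟨y, fun _ => hy⟩
    · exact ⟨0, fun h => absurd h hv⟩
  choose y hy using hex
  have hmem : ∀ v, ‖v‖ < r → ∀ t ∈ Icc (0 : ℝ) 1, P (x₀ + t • v) (y v t) = y v t := by
    intro v hv
    refine transport_mem_range (C := M₁ * M) (fun t ht => hPd _ (hBU (hray v hv t ht))) ?_
      (fun t ht => hPP _ (hBU (hray v hv t ht))) (hy v hv).2 (by rw [(hy v hv).1, hy₀])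
    intro t ht
    have h1 := hPM _ (Metric.ball_subset_ball hr1 (hray v hv t ht))
    have h2 : ‖fderiv ℝ P (x₀ + t • v) v‖ ≤ M := by
      refine ((fderiv ℝ P (x₀ + t • v)).le_opNorm_of_le (hv.le.trans hr4)).trans ?_
      rw [mul_one]
      exact (hAM _ (hB2 (hray v hv t ht))).trans hM2
    exact mul_le_mul h1 h2 (norm_nonneg _) hM₁.le
  refine ⟨fun x => y (x - x₀) 1, ?_, fun x hx => ?_⟩
  · -- along the constant ray the solution is constant
    have h0 : ‖x₀ - x₀‖ < r := by simpa using hrpos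
    have h1 := (hy _ h0).2
    simp only [sub_self, smul_zero, add_zero, map_zero, zero_apply] at h1
    have h2 : y (x₀ - x₀) 1 = y (x₀ - x₀) 0 := by
      rw [sub_self]
      exact constant_of_has_deriv_right_zero (fun t ht => (h1 t ht).continuousWithinAt)
        (fun t ht => hasDerivWithinAt_Ici_of_Icc ht (h1 t (Ico_subset_Icc_self ht))) 1 (by simp)
    exact h2.trans (hy _ h0).1
  set v := x - x₀ with hv
  have hxv : x₀ + v = x := by rw [hv]; abel
  have hvr : ‖v‖ < r := by rwa [hv, ← mem_ball_iff_norm]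
  constructor
  · have := hmem v hvr 1 (by simp)
    rwa [one_smul, hxv] at this
  obtain ⟨C, hC⟩ := isCompact_Icc.exists_bound_of_continuousOn
    (fun t ht => ((hy v hvr).2 t ht).continuousWithinAt)
  rw [hasFDerivAt_iff_isLittleO_nhds_zero]
  refine Asymptotics.IsBigO.trans_isLittleO (g := fun h : E => ‖h‖ ^ 2) ?_
    (Asymptotics.isLittleO_norm_pow_id one_lt_two)
  refine Asymptotics.IsBigO.of_bound
    ((2 * M * C + 2 * M * (M * C)) / M * (Real.exp M - 1)) ?_
  have hev : ∀ᶠ h in nhds (0 : E), ‖v + h‖ < r := by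
    have : Filter.Tendsto (fun h : E => ‖v + h‖) (nhds 0) (nhds ‖v‖) := by
      have := (continuous_const.add continuous_id : Continuous fun h : E => v + h).norm.tendsto 0
      simpa using this
    exact this.eventually (gt_mem_nhds hvr)
  filter_upwards [hev] with h hh
  have hxh : x + h - x₀ = v + h := by rw [hv]; abel
  have hmain := transport_compare (A := fderiv ℝ P) (A' := fderiv ℝ (fderiv ℝ P))
    (B := Metric.ball x₀ r) (x₀ := x₀) (v := v) (h := h) (M := M) (C := C) (y := y v)
    (y₂ := y (v + h)) (by linarith) (fun z hz => (hAd z (hBU hz)).hasFDerivAt)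
    (fun z hz w w' => ((hP.contDiffAt (hU.mem_nhds (hBU hz))).isSymmSndFDerivAt
      (by simpa using (WithTop.coe_le_coe.2 le_top : ((2 : ℕ∞) : WithTop ℕ∞) ≤ ∞))) w w')
    (fun z hz => (hAM z (hB2 hz)).trans hM2)
    (fun z hz w hw => (hLip z (hB2 hz) w (hB2 hw)).trans (by gcongr))
    (fun z hz w hw => (hTay z (hB2 hz) w (hB2 hw)).trans (by gcongr))
    (hvr.le.trans hr4) (hh.le.trans hr4) (hray v hvr) (hray _ hh) (hy v hvr).2 (hy _ hh).2
    ((hy _ hh).1.trans (hy v hvr).1.symm) hC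
    (fun t ht w z => hcomm _ (hBU (hray v hvr t ht)) _ (hmem v hvr t ht) w z)
  rw [hxv] at hmain
  rw [hxh]
  simpa using hmain

/-- A solution of the linear equation `dc = A c` with smooth `A` is smooth. -/
lemma contDiffOn_of_linear_pde {U : Set E} (hU : IsOpen U) {A : E → E →L[ℝ] F →L[ℝ] F}
    (hA : ContDiffOn ℝ ∞ A U) {c : E → F} (hc : ∀ x ∈ U, HasFDerivAt c ((A x).flip (c x)) x) :
    ContDiffOn ℝ ∞ c U := by
  rw [contDiffOn_infty]
  intro N
  induction N with
  | zero =>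
    exact contDiffOn_zero.2 fun x hx => (hc x hx).continuousAt.continuousWithinAt
  | succ N ih =>
    push_cast
    rw [contDiffOn_succ_iff_fderiv_of_isOpen hU]
    refine ⟨fun x hx => (hc x hx).differentiableAt.differentiableWithinAt, by simp, ?_⟩
    have h0 : ContDiffOn ℝ N A U := hA.of_le (by exact_mod_cast le_top)
    have hflip := LinearIsometryEquiv.contDiff (n := N) (𝕜 := ℝ) (E := E →L[ℝ] F →L[ℝ] F)
      (F := F →L[ℝ] E →L[ℝ] F) (ContinuousLinearMap.flipₗᵢ ℝ E F F)
    have h1 : ContDiffOn ℝ N (fun x => (A x).flip) U := hflip.comp_contDiffOn h0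
    have h2 : ContDiffOn ℝ N (fun x => (A x).flip (c x)) U := h1.clm_apply ih
    exact h2.congr fun x hx => (hc x hx).fderiv

end Transport

/-! ### The normal projection of an immersion with flat normal bundle -/

section NormalProjection

variable {n : ℕ} {F : Type*} [NormedAddCommGroup F] [InnerProductSpace ℝ F]

/-- The unit vector in the direction of `∂g/∂u_k`. -/
noncomputable def unitTangent (g : Eu n → F) (k : Fin n) (u : Eu n) : F :=
  ‖pd k g u‖⁻¹ • pd k g u

/-- The projection onto the normal space, by its formula for orthogonal coordinate vectors. -/
noncomputable def normalCLM (g : Eu n → F) (u : Eu n) : F →L[ℝ] F :=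
  ContinuousLinearMap.id ℝ F - (innerSL ℝ (g u)).smulRight (g u) -
    ∑ k, (innerSL ℝ (unitTangent g k u)).smulRight (unitTangent g k u)

lemma normalCLM_apply (g : Eu n → F) (u : Eu n) (v : F) :
    normalCLM g u v = v - inner ℝ (g u) v • g u -
      ∑ k, inner ℝ (unitTangent g k u) v • unitTangent g k u := by
  simp [normalCLM]

variable [FiniteDimensional ℝ F] {g : Eu n → F} {V : Set (Eu n)}

/-- A spherical immersion of `V` with `V` in principal coordinates. -/
structure IsPrincipalImmersion (g : Eu n → F) (V : Set (Eu n)) : Prop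
    extends IsSphericalImmersion g V where
  principal : HasPrincipalCoordinates g V

namespace IsPrincipalImmersion

variable (h : IsPrincipalImmersion g V) {u : Eu n}
include h

lemma smooth_unitTangent (k : Fin n) : ContDiffOn ℝ ∞ (unitTangent g k) V := by
  have h1 := contDiffOn_pd h.isOpen h.smooth k
  have h0 : ∀ u ∈ V, pd k g u ≠ 0 := fun u hu => pd_ne_zero (h.injective u hu) k
  exact ((h1.norm ℝ h0).inv fun u hu => norm_ne_zero_iff.2 (h0 u hu)).smul h1

lemma smooth_normalCLM : ContDiffOn ℝ ∞ (normalCLM g) V := by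
  rw [contDiffOn_clm_apply]
  intro v
  simp only [normalCLM_apply]
  refine (contDiffOn_const.sub ((h.smooth.inner ℝ contDiffOn_const).smul h.smooth)).sub ?_
  exact ContDiffOn.sum fun k _ =>
    ((h.smooth_unitTangent k).inner ℝ contDiffOn_const).smul (h.smooth_unitTangent k)

variable (hu : u ∈ V)
include hu

lemma norm_pd_ne_zero (k : Fin n) : ‖pd k g u‖ ≠ 0 :=
  norm_ne_zero_iff.2 (pd_ne_zero (h.injective u hu) k)

lemma pd_eq (k : Fin n) : pd k g u = ‖pd k g u‖ • unitTangent g k u := by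
  rw [unitTangent, smul_inv_smul₀ (h.norm_pd_ne_zero hu k)]

lemma norm_eq_one : ‖g u‖ = 1 := mem_sphere_zero_iff_norm.1 (h.mem_sphere u hu)

lemma inner_self : inner ℝ (g u) (g u) = (1 : ℝ) := by
  rw [real_inner_self_eq_norm_sq, h.norm_eq_one hu, one_pow]

lemma inner_pd (k : Fin n) : inner ℝ (g u) (pd k g u) = 0 := by
  have hd := diffAt h.isOpen h.smooth hu
  have h1 := pd_congr_on h.isOpen hu (fun v hv => h.inner_self hv) k
  rw [pd_inner hd hd, pd_const, real_inner_comm] at h1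
  linarith

lemma inner_unitTangent (k l : Fin n) :
    inner ℝ (unitTangent g k u) (unitTangent g l u) = if k = l then (1 : ℝ) else 0 := by
  rw [unitTangent, unitTangent, inner_smul_left, inner_smul_right]
  split_ifs with hkl
  · subst hkl
    have := h.norm_pd_ne_zero hu k
    rw [real_inner_self_eq_norm_sq]
    simp only [conj_trivial]
    field_simp
  · rw [(h.principal u hu k l hkl).1, mul_zero, mul_zero]

lemma inner_position_unitTangent (k : Fin n) : inner ℝ (g u) (unitTangent g k u) = (0 : ℝ) := by
  rw [unitTangent, inner_smul_right, h.inner_pd hu, mul_zero]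

lemma mem_normalSpace_iff {v : F} :
    v ∈ normalSpace g u ↔ inner ℝ (g u) v = (0 : ℝ) ∧
      ∀ k, inner ℝ (unitTangent g k u) v = (0 : ℝ) := by
  rw [Ferapontov.mem_normalSpace_iff]
  refine and_congr_right fun _ => forall_congr' fun k => ?_
  rw [unitTangent, inner_smul_left]
  simp [pd_ne_zero (h.injective u hu) k]

lemma normalProj_eq (v : F) : normalProj g u v = normalCLM g u v := by
  refine normalProj_eq_of_mem ?_ fun z hz => ?_
  · rw [h.mem_normalSpace_iff hu, normalCLM_apply]
    constructor
    · simp [inner_sub_right, inner_sum, inner_smul_right, h.norm_eq_one hu,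
        h.inner_position_unitTangent hu]
    · intro k
      simp [inner_sub_right, inner_sum, inner_smul_right, h.inner_unitTangent hu,
        real_inner_comm (g u), h.inner_position_unitTangent hu]
  · rw [h.mem_normalSpace_iff hu] at hz
    rw [normalCLM_apply, sub_sub, sub_sub_cancel]
    simp [inner_add_left, sum_inner, inner_smul_left, hz.1, hz.2]

lemma normalCLM_eq_self_iff {v : F} : normalCLM g u v = v ↔ v ∈ normalSpace g u := by
  rw [← h.normalProj_eq hu]
  exact Submodule.starProjection_eq_self_iff

lemma normalCLM_mem (v : F) : normalCLM g u v ∈ normalSpace g u := by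
  rw [← h.normalProj_eq hu]
  exact Submodule.starProjection_apply_mem _ _

lemma normalCLM_idem (v : F) : normalCLM g u (normalCLM g u v) = normalCLM g u v :=
  (h.normalCLM_eq_self_iff hu).2 (h.normalCLM_mem hu v)

/-- The derivative of the relation `P² = P` for the normal projection `P`. -/
lemma pd_normalCLM_idem (k : Fin n) (v : F) :
    pd k (normalCLM g) u (normalCLM g u v) + normalCLM g u (pd k (normalCLM g) u v) =
      pd k (normalCLM g) u v := by
  have hd := diffAt h.isOpen h.smooth_normalCLM hu
  have hc : ∀ w : F, DifferentiableAt ℝ (fun _ : Eu n => w) u := fun w => differentiableAt_const w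
  have h1 := pd_congr_on h.isOpen hu (fun w hw => h.normalCLM_idem hw v) k
  rw [pd_clm_apply hd (hd.clm_apply (hc v)), pd_clm_apply hd (hc v), pd_const, map_zero,
    add_zero] at h1
  exact h1

lemma normalCLM_pd_of_mem {y : F} (hy : normalCLM g u y = y) (k : Fin n) :
    normalCLM g u (pd k (normalCLM g) u y) = 0 := by
  have := h.pd_normalCLM_idem hu k y
  rwa [hy, add_eq_left] at this

/-- On normal vectors, the derivatives of the normal projection commute if the normal bundle is
flat: the normal fields `P w` with constant `w` have curvature `P [∂_j P, ∂_k P] w`. -/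
lemma pd_normalCLM_comm (hflat : HasFlatNormalBundle g V) {y : F} (hy : normalCLM g u y = y)
    (j k : Fin n) : pd j (normalCLM g) u (pd k (normalCLM g) u y) =
      pd k (normalCLM g) u (pd j (normalCLM g) u y) := by
  have hV := h.isOpen
  have hP := h.smooth_normalCLM
  have hc : ∀ u : Eu n, DifferentiableAt ℝ (fun _ : Eu n => y) u := fun u =>
    differentiableAt_const y
  have hD : ∀ k, ∀ v ∈ V, normalD g k (fun w => normalCLM g w y) v =
      normalCLM g v (pd k (normalCLM g) v y) := by
    intro k v hv
    rw [normalD, h.normalProj_eq hv, pd_clm_apply (diffAt hV hP hv) (hc v), pd_const, map_zero,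
      add_zero]
  have hDD : ∀ j k, normalD g j (normalD g k (fun w => normalCLM g w y)) u =
      pd j (normalCLM g) u (pd k (normalCLM g) u y) +
        normalCLM g u (pd j (pd k (normalCLM g)) u y) := by
    intro j k
    have hPk := diffAt hV (contDiffOn_pd hV hP k) hu
    -- `∂_j P` maps the kernel of `P` to its range
    have hr : normalCLM g u (pd j (normalCLM g) u (pd k (normalCLM g) u y)) =
        pd j (normalCLM g) u (pd k (normalCLM g) u y) := by
      have := h.pd_normalCLM_idem hu j (pd k (normalCLM g) u y)
      rwa [h.normalCLM_pd_of_mem hu hy, map_zero, zero_add] at this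
    rw [normalD, h.normalProj_eq hu, pd_congr_on hV hu (hD k),
      pd_clm_apply (diffAt hV hP hu) (hPk.clm_apply (hc u)), pd_clm_apply hPk (hc u), pd_const,
      map_zero, add_zero, map_add, hr, h.normalCLM_idem hu]
  have hfl := hflat V hV subset_rfl (fun w => normalCLM g w y) (hP.clm_apply contDiffOn_const)
    (fun v hv => h.normalCLM_mem hv y) j k u hu
  rw [hDD, hDD, pd_comm hV hP hu j k] at hfl
  exact add_right_cancel hfl

lemma fderiv_normalCLM_comm (hflat : HasFlatNormalBundle g V) {y : F}
    (hy : normalCLM g u y = y) (w z : Eu n) :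
    fderiv ℝ (normalCLM g) u w (fderiv ℝ (normalCLM g) u z y) =
      fderiv ℝ (normalCLM g) u z (fderiv ℝ (normalCLM g) u w y) := by
  simp only [fderiv_apply_eq_sum, sum_apply, map_sum, smul_apply, map_smul,
    Finset.smul_sum]
  rw [Finset.sum_comm]
  refine Finset.sum_congr rfl fun j _ => Finset.sum_congr rfl fun k _ => ?_
  rw [h.pd_normalCLM_comm hu hflat hy, smul_comm]

omit hu in
/-- A parallel normal field changes in the direction `u_k` by a multiple of `∂g/∂u_k`, because the
second fundamental form is diagonal. -/
lemma pd_parallel {O : Set (Eu n)} (hO : IsOpen O) (hOV : O ⊆ V) {c : Eu n → F}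
    (hc : ∀ u ∈ O, DifferentiableAt ℝ c u) (hn : ∀ u ∈ O, normalCLM g u (c u) = c u)
    (hu : u ∈ O) (k : Fin n) (hp : pd k c u = pd k (normalCLM g) u (c u)) :
    pd k c u = inner ℝ (unitTangent g k u) (pd k c u) • unitTangent g k u := by
  have huV := hOV hu
  have hns : ∀ v ∈ O, c v ∈ normalSpace g v := fun v hv =>
    (h.normalCLM_eq_self_iff (hOV hv)).1 (hn v hv)
  have hgd := diffAt h.isOpen h.smooth huV
  have h1 : inner ℝ (g u) (pd k c u) = (0 : ℝ) := by
    have h2 := pd_congr_on hO hu (fun v hv => (Ferapontov.mem_normalSpace_iff.1 (hns v hv)).1) k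
    rw [pd_inner hgd (hc u hu), pd_const, (Ferapontov.mem_normalSpace_iff.1 (hns u hu)).2 k,
      zero_add] at h2
    exact h2
  have h3 : ∀ l, l ≠ k → inner ℝ (unitTangent g l u) (pd k c u) = (0 : ℝ) := by
    intro l hl
    have h2 := pd_congr_on hO hu
      (fun v hv => (Ferapontov.mem_normalSpace_iff.1 (hns v hv)).2 l) k
    have h4 : inner ℝ (pd k (pd l g) u) (c u) = (0 : ℝ) := by
      have h5 := (h.principal u huV k l hl.symm).2
      have h6 : inner ℝ (normalProj g u (pd k (pd l g) u)) (c u) =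
          inner ℝ (pd k (pd l g) u) (normalProj g u (c u)) :=
        Submodule.inner_starProjection_left_eq_right _ _ _
      rw [h.normalProj_eq huV (c u), hn u hu] at h6
      rw [← h6]
      change normalProj g u (pd k (pd l g) u) = 0 at h5
      rw [h5, inner_zero_left]
    rw [pd_inner (diffAt h.isOpen (contDiffOn_pd h.isOpen h.smooth l) huV) (hc u hu), pd_const,
      h4, zero_add] at h2
    rw [unitTangent, inner_smul_left, h2, mul_zero]
  have h7 : normalCLM g u (pd k c u) = 0 := by
    rw [hp]
    exact h.normalCLM_pd_of_mem huV (hn u hu) k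
  rw [normalCLM_apply, h1, zero_smul, sub_zero, sub_eq_zero,
    Finset.sum_eq_single k (fun l _ hl => by rw [h3 l hl, zero_smul]) (by simp)] at h7
  exact h7

end IsPrincipalImmersion

end NormalProjection

section ExistsFrame

variable {n m : ℕ} {g : Eu n → Amb n m} {V : Set (Eu n)}

/-- Near any point, a spherical immersion with flat normal bundle in principal coordinates is a
column of a parallel frame. -/
theorem IsPrincipalImmersion.exists_isParallelFrame (h : IsPrincipalImmersion g V)
    (hflat : HasFlatNormalBundle g V) (a : Fin m) {u₀ : Eu n} (hu₀ : u₀ ∈ V) :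
    ∃ r > 0, Metric.ball u₀ r ⊆ V ∧ ∃ (W : Fin m → Eu n → Amb n m)
      (C : Fin n → Fin m → Eu n → ℝ),
      IsParallelFrame (Metric.ball u₀ r) W (unitTangent g) C ∧ W a = g ∧
      ∀ k, ∀ u ∈ Metric.ball u₀ r, C k a u ≠ 0 := by
  classical
  obtain ⟨r, hr, hrV, hpar⟩ := exists_parallel_section h.isOpen h.smooth_normalCLM
    (fun u hu z => h.normalCLM_idem hu z)
    (fun u hu y hy w z => h.fderiv_normalCLM_comm hu hflat hy w z) hu₀
  set B := Metric.ball u₀ r with hB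
  have hBo : IsOpen B := Metric.isOpen_ball
  have hu₀B : u₀ ∈ B := Metric.mem_ball_self hr
  -- complete the tangent frame and the position vector at `u₀` to an orthonormal basis
  let e : Fin n ⊕ Fin m → Amb n m := Sum.elim (fun k => unitTangent g k u₀) (fun _ => g u₀)
  let S : Set (Fin n ⊕ Fin m) := {i | ∀ b, i = Sum.inr b → b = a}
  have he : Orthonormal ℝ (S.domRestrict e) := by
    rw [orthonormal_iff_ite]
    rintro ⟨k | b, hi⟩ ⟨l | c, hj⟩
    · change inner ℝ (unitTangent g k u₀) (unitTangent g l u₀) = _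
      simp [h.inner_unitTangent hu₀]
    · change inner ℝ (unitTangent g k u₀) (g u₀) = _
      simp [real_inner_comm (g u₀), h.inner_position_unitTangent hu₀]
    · change inner ℝ (g u₀) (unitTangent g l u₀) = _
      simp [h.inner_position_unitTangent hu₀]
    · obtain rfl := hi b rfl
      obtain rfl := hj c rfl
      change inner ℝ (g u₀) (g u₀) = _
      simp [h.norm_eq_one hu₀]
  obtain ⟨b₀, hb₀⟩ := he.exists_orthonormalBasis_extension_of_card_eq (by simp)
  have hb₀t : ∀ k, b₀ (Sum.inl k) = unitTangent g k u₀ := fun k => hb₀ _ (by simp [S])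
  have hb₀a : b₀ (Sum.inr a) = g u₀ := hb₀ _ (by simp [S])
  have hnorm : ∀ b, b ≠ a → normalCLM g u₀ (b₀ (Sum.inr b)) = b₀ (Sum.inr b) := by
    intro b hb
    rw [h.normalCLM_eq_self_iff hu₀, h.mem_normalSpace_iff hu₀, ← hb₀a]
    refine ⟨?_, fun k => ?_⟩
    · rw [orthonormal_iff_ite.1 b₀.orthonormal]
      simp [hb.symm]
    · rw [← hb₀t, orthonormal_iff_ite.1 b₀.orthonormal]
      simp
  have hex : ∀ b, ∃ c : Eu n → Amb n m, b ≠ a → c u₀ = b₀ (Sum.inr b) ∧ ∀ u ∈ B,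
      normalCLM g u (c u) = c u ∧ HasFDerivAt c ((fderiv ℝ (normalCLM g) u).flip (c u)) u := by
    intro b
    by_cases hb : b = a
    · exact ⟨0, fun h => absurd hb h⟩
    · obtain ⟨c, hc⟩ := hpar _ (hnorm b hb)
      exact ⟨c, fun _ => hc⟩
  choose c hc using hex
  let W : Fin m → Eu n → Amb n m := fun b => if b = a then g else c b
  have hWa : W a = g := if_pos rfl
  have hWb : ∀ b, b ≠ a → W b = c b := fun b hb => if_neg hb
  have hsm : ∀ b, ContDiffOn ℝ ∞ (W b) B := by
    intro b
    by_cases hb : b = a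
    · rw [hb, hWa]
      exact h.smooth.mono hrV
    · rw [hWb b hb]
      exact contDiffOn_of_linear_pde hBo
        (contDiffOn_fderiv h.isOpen h.smooth_normalCLM |>.mono hrV)
        fun u hu => ((hc b hb).2 u hu).2
  let C : Fin n → Fin m → Eu n → ℝ := fun k b u => inner ℝ (unitTangent g k u) (pd k (W b) u)
  have hpd : ∀ k b, ∀ u ∈ B, pd k (W b) u = C k b u • unitTangent g k u := by
    intro k b u hu
    by_cases hb : b = a
    · have h1 := h.pd_eq (hrV hu) k
      simp only [C, hb, hWa]
      rw [h1, inner_smul_right, h.inner_unitTangent (hrV hu)]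
      simp [← h1]
    · simp only [C, hWb b hb]
      refine h.pd_parallel hBo hrV (fun u hu => ((hc b hb).2 u hu).2.differentiableAt)
        (fun u hu => ((hc b hb).2 u hu).1) hu k ?_
      rw [pd_of_hasFDerivAt ((hc b hb).2 u hu).2]
      rfl
  have htn : ∀ k b, ∀ u ∈ B, inner ℝ (unitTangent g k u) (W b u) = (0 : ℝ) := by
    intro k b u hu
    by_cases hb : b = a
    · rw [hb, hWa, real_inner_comm, h.inner_position_unitTangent (hrV hu)]
    · have h1 := ((hc b hb).2 u hu).1
      rw [h.normalCLM_eq_self_iff (hrV hu), h.mem_normalSpace_iff (hrV hu)] at h1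
      rw [hWb b hb]
      exact h1.2 k
  have hW₀ : ∀ b, W b u₀ = b₀ (Sum.inr b) := by
    intro b
    by_cases hb : b = a
    · rw [hb, hWa, hb₀a]
    · rw [hWb b hb, (hc b hb).1]
  -- inner products of parallel fields are constant
  have hWW : ∀ b d, ∀ u ∈ B, inner ℝ (W b u) (W d u) = if b = d then (1 : ℝ) else 0 := by
    intro b d u hu
    have h1 : inner ℝ (W b u) (W d u) = inner ℝ (W b u₀) (W d u₀) := by
      refine eq_of_pd_eq_zero (f := fun v => inner ℝ (W b v) (W d v)) hBo
        (convex_ball u₀ r).isPreconnected (fun v hv => (diffAt hBo (hsm b) hv).inner ℝ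
          (diffAt hBo (hsm d) hv)) (fun k v hv => ?_) hu hu₀B
      rw [pd_inner (diffAt hBo (hsm b) hv) (diffAt hBo (hsm d) hv), hpd k b v hv, hpd k d v hv,
        inner_smul_left, inner_smul_right, htn k d v hv, real_inner_comm, htn k b v hv]
      simp
    rw [h1, hW₀, hW₀, orthonormal_iff_ite.1 b₀.orthonormal]
    simp
  refine ⟨r, hr, hrV, W, C, ⟨hsm, fun u hu => ?_, hpd⟩, hWa, fun k u hu => ?_⟩
  · rw [orthonormal_iff_ite]
    rintro (k | b) (l | d)
    · simpa using h.inner_unitTangent (hrV hu) k l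
    · simpa using htn k d u hu
    · simpa [real_inner_comm] using htn l b u hu
    · simpa using hWW b d u hu
  · have h1 := hpd k a u hu
    intro h0
    rw [h0, zero_smul, hWa] at h1
    exact pd_ne_zero (h.injective u (hrV hu)) k h1

end ExistsFrame

/-! ### Rotating a parallel frame -/

section Rotation

open Module in
/-- Two linear isometries that differ at a unit vector `e` differ at every nonzero vector, after
one of them is composed with a suitable rotation fixing `e`. If `A Q v = ι v`, composing `Q` with
the reflection in the part of `v` orthogonal to `e` makes the space of coincidences smaller. -/
theorem exists_isometry_forall_ne {E F : Type*} [NormedAddCommGroup E] [InnerProductSpace ℝ E]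
    [FiniteDimensional ℝ E] [NormedAddCommGroup F] [InnerProductSpace ℝ F] (A ι : E →ₗᵢ[ℝ] F)
    {e : E} (he : ‖e‖ = 1) (hne : A e ≠ ι e) :
    ∃ Q : E ≃ₗᵢ[ℝ] E, Q e = e ∧ ∀ x, A (Q x) = ι x → x = 0 := by
  let fix : (E ≃ₗᵢ[ℝ] E) → Submodule ℝ E := fun Q =>
    LinearMap.eqLocus (A.toLinearMap ∘ₗ Q.toLinearEquiv.toLinearMap) ι.toLinearMap
  have hfix : ∀ Q x, x ∈ fix Q ↔ A (Q x) = ι x := fun Q x => Iff.rfl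
  suffices H : ∀ N, ∀ Q : E ≃ₗᵢ[ℝ] E, Q e = e → finrank ℝ (fix Q) = N →
      ∃ Q : E ≃ₗᵢ[ℝ] E, Q e = e ∧ ∀ x, A (Q x) = ι x → x = 0 from
    H _ (LinearIsometryEquiv.refl ℝ E) rfl rfl
  intro N
  induction N using Nat.strong_induction_on with
  | _ N ih =>
  intro Q hQ hN
  by_cases hex : ∀ x, A (Q x) = ι x → x = 0
  · exact ⟨Q, hQ, hex⟩
  push Not at hex
  obtain ⟨v, hv, hv0⟩ := hex
  set r := v - inner ℝ e v • e with hr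
  have hre : inner ℝ r e = (0 : ℝ) := by
    rw [hr, inner_sub_left, inner_smul_left, real_inner_self_eq_norm_sq, he, real_inner_comm]
    simp
  have hr0 : r ≠ 0 := by
    intro h0
    have hve : v = inner ℝ e v • e := sub_eq_zero.1 h0
    have h1 : inner ℝ e v • A e = inner ℝ e v • ι e := by
      rw [← map_smul, ← map_smul, ← hve, ← hv]
      conv_lhs => rw [hve, ← hQ, ← map_smul]
      conv_rhs => rw [hve, ← hQ, hQ]
      rw [hQ]
    rcases eq_or_ne (inner ℝ e v) (0 : ℝ) with h2 | h2
    · rw [h2, zero_smul] at hve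
      exact hv0 hve
    · exact hne (smul_right_injective F h2 h1)
  have hrv : inner ℝ r v = inner ℝ r r := by
    conv_rhs => rw [hr, inner_sub_right, inner_smul_right, ← hr, hre, mul_zero, sub_zero]
  have hrr : inner ℝ r r ≠ (0 : ℝ) := inner_self_ne_zero.2 hr0
  let R : E ≃ₗᵢ[ℝ] E := (ℝ ∙ r)ᗮ.reflection
  have hR : ∀ x, R x = x - (2 * (inner ℝ r x / inner ℝ r r)) • r := by
    intro x
    simp only [R, Submodule.reflection_orthogonal_apply, Submodule.reflection_singleton_apply]
    rw [real_inner_self_eq_norm_sq, mul_smul, two_smul, two_smul]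
    simp
  have hRe : R e = e := by rw [hR, hre]; simp
  refine ih _ ?_ (R.trans Q) (by rw [LinearIsometryEquiv.trans_apply, hRe, hQ]) rfl
  rw [← hN]
  have hmem : ∀ x, x ∈ fix (R.trans Q) → inner ℝ r x = (0 : ℝ) := by
    intro x hx
    rw [hfix, LinearIsometryEquiv.trans_apply] at hx
    have h1 : inner ℝ (R x) v = inner ℝ x v := by
      rw [← Q.inner_map_map, ← A.inner_map_map, hx, hv, ι.inner_map_map]
    rw [hR, inner_sub_left, inner_smul_left, hrv, sub_eq_self] at h1
    simpa [hrr, hr0] using h1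
  refine Submodule.finrank_lt_finrank_of_lt (lt_of_le_of_ne (fun x hx => ?_) fun heq => ?_)
  · have h1 : R x = x := by rw [hR, hmem x hx]; simp
    rw [hfix, LinearIsometryEquiv.trans_apply, h1] at hx
    exact hx
  · have h1 : v ∈ fix (R.trans Q) := by rw [heq]; exact hv
    exact hrr (hrv ▸ hmem v h1)

variable {n m : ℕ} {U : Set (Eu n)} {W : Fin m → Eu n → Amb n m} {ξ : Fin n → Eu n → Amb n m}
  {C : Fin n → Fin m → Eu n → ℝ}

/-- A constant rotation of the `W_b` gives a parallel frame again. -/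
lemma IsParallelFrame.rotate (h : IsParallelFrame U W ξ C) (hU : IsOpen U)
    (Q : Eu m ≃ₗᵢ[ℝ] Eu m) :
    IsParallelFrame U (fun b u => ∑ c, Q (EuclideanSpace.single b 1) c • W c u) ξ
      (fun k b u => ∑ c, Q (EuclideanSpace.single b 1) c * C k c u) where
  smooth b := ContDiffOn.sum fun c _ =>
    (contDiffOn_const (c := Q (EuclideanSpace.single b 1) c)).smul (h.smooth c)
  orthonormal u hu := by
    rw [orthonormal_iff_ite]
    rintro (k | b) (l | d)
    · simpa using h.inner_tangent hu k l
    · simp [inner_sum, inner_smul_right, h.inner_tangent_normal hu]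
    · simp [inner_sum, inner_smul_right, real_inner_comm (ξ l u), h.inner_tangent_normal hu]
    · have h1 : inner ℝ (Q (EuclideanSpace.single b 1)) (Q (EuclideanSpace.single d 1)) =
          if b = d then (1 : ℝ) else 0 := by
        rw [Q.inner_map_map, EuclideanSpace.inner_single_left]
        simp
      rw [PiLp.inner_apply] at h1
      simp only [Sum.elim_inr, Sum.inr.injEq]
      rw [← h1, sum_inner]
      refine Finset.sum_congr rfl fun c _ => ?_
      simp [inner_sum, inner_smul_left, inner_smul_right, h.inner_normal hu, mul_comm]
  pd_eq k b u hu := by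
    rw [pd_sum _ fun c _ => (diffAt hU (h.smooth c) hu).fun_const_smul _, Finset.sum_smul]
    refine Finset.sum_congr rfl fun c _ => ?_
    have := pd_clm (Q (EuclideanSpace.single b 1) c • ContinuousLinearMap.id ℝ (Amb n m))
      (diffAt hU (h.smooth c) hu) k
    rw [mul_smul, ← h.pd_eq k c u hu]
    exact this

lemma IsParallelFrame.neg (h : IsParallelFrame U W ξ C) :
    IsParallelFrame U (fun b u => -W b u) ξ (fun k b u => -C k b u) where
  smooth b := (h.smooth b).neg
  orthonormal u hu := by
    rw [orthonormal_iff_ite]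
    rintro (k | b) (l | d)
    · simpa using h.inner_tangent hu k l
    · simpa using h.inner_tangent_normal hu k d
    · simpa [real_inner_comm] using h.inner_tangent_normal hu l b
    · simpa using h.inner_normal hu b d
  pd_eq k b u hu := by
    rw [pd_neg, h.pd_eq k b u hu, neg_smul]

/-- The upper block of the matrix with columns `W_b`. -/
def upper {κ : Type*} (W : κ → Eu n → Amb n m) (u : Eu n) : Matrix (Fin n) κ ℝ :=
  Matrix.of fun i b => W b u (Sum.inl i)

/-- The lower block of the matrix with columns `W_b`. -/
def lower {κ : Type*} (W : κ → Eu n → Amb n m) (u : Eu n) : Matrix (Fin m) κ ℝ :=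
  Matrix.of fun c b => W b u (Sum.inr c)

/-- If `W_a` is not the basis vector `e_{n+a}` at a point, a rotation of the frame fixing `W_a`
makes `1 - lower W` invertible there. -/
theorem IsParallelFrame.exists_isUnit_one_sub_lower (h : IsParallelFrame U W ξ C) (hU : IsOpen U)
    {u₀ : Eu n} (hu₀ : u₀ ∈ U) {a : Fin m} (ha : W a u₀ ≠ EuclideanSpace.single (Sum.inr a) 1) :
    ∃ W' C', IsParallelFrame U W' ξ C' ∧ W' a = W a ∧ (∀ k, C' k a = C k a) ∧
      IsUnit (1 - lower W' u₀) := by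
  let A : Eu m →ₗᵢ[ℝ] Amb n m := LinearMap.isometryOfInner
    (∑ b, (EuclideanSpace.proj (𝕜 := ℝ) b : Eu m →L[ℝ] ℝ).toLinearMap.smulRight (W b u₀)) (by
      intro x y
      simp [sum_inner, inner_sum, inner_smul_left, inner_smul_right, h.inner_normal hu₀,
        PiLp.inner_apply, mul_comm])
  have hA : ∀ x, A x = ∑ b, x b • W b u₀ := fun x => by simp [A]
  let ι : Eu m →ₗᵢ[ℝ] Amb n m := LinearMap.isometryOfInner
    (∑ b, (EuclideanSpace.proj (𝕜 := ℝ) b : Eu m →L[ℝ] ℝ).toLinearMap.smulRight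
      (EuclideanSpace.single (Sum.inr b) (1 : ℝ) : Amb n m)) (by
      intro x y
      simp [sum_inner, inner_sum, inner_smul_left, inner_smul_right, PiLp.inner_apply, mul_comm])
  have hι : ∀ x, ι x = ∑ b, x b • (EuclideanSpace.single (Sum.inr b) (1 : ℝ) : Amb n m) :=
    fun x => by simp [ι]
  obtain ⟨Q, hQa, hQ⟩ := exists_isometry_forall_ne A ι
    (e := EuclideanSpace.single a (1 : ℝ)) (by simp) (by simpa [hA, hι, Pi.single_apply] using ha)
  refine ⟨_, _, h.rotate hU Q, ?_, ?_, ?_⟩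
  · funext u
    simp [hQa]
  · intro k
    funext u
    simp [hQa]
  set W' : Fin m → Eu n → Amb n m := fun b u => ∑ c, Q (EuclideanSpace.single b 1) c • W c u
    with hW'
  have h' := h.rotate hU Q
  rw [← Matrix.mulVec_injective_iff_isUnit]
  refine (injective_iff_map_eq_zero (Matrix.mulVecLin (1 - lower W' u₀))).2 fun x hx => ?_
  rw [Matrix.mulVecLin_apply, Matrix.sub_mulVec, Matrix.one_mulVec, sub_eq_zero] at hx
  have hAQ : A (Q (WithLp.toLp 2 x)) = ∑ b, x b • W' b u₀ := by
    have h1 : (WithLp.toLp 2 x : Eu m) = ∑ b, x b • EuclideanSpace.single b (1 : ℝ) :=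
      eu_eq_sum _
    rw [h1, map_sum, map_sum]
    refine Finset.sum_congr rfl fun b _ => ?_
    rw [map_smul, map_smul, hA]
  have hlow : ∀ c, A (Q (WithLp.toLp 2 x)) (Sum.inr c) = x c := by
    intro c
    rw [hAQ]
    conv_rhs => rw [hx]
    simp [lower, Matrix.mulVec, dotProduct, mul_comm]
  -- the isometry leaves no room for the upper components
  have hup : ∀ i, A (Q (WithLp.toLp 2 x)) (Sum.inl i) = 0 := by
    have h1 : ‖A (Q (WithLp.toLp 2 x))‖ ^ 2 = ‖(WithLp.toLp 2 x : Eu m)‖ ^ 2 := by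
      rw [A.norm_map, Q.norm_map]
    rw [EuclideanSpace.norm_sq_eq, EuclideanSpace.norm_sq_eq, Fintype.sum_sum_type] at h1
    simp only [hlow, add_eq_right] at h1
    intro i
    have h2 := (Finset.sum_eq_zero_iff_of_nonneg fun i _ => sq_nonneg _).1 h1 i (Finset.mem_univ i)
    simpa using h2
  have hfin : (WithLp.toLp 2 x : Eu m) = 0 := by
    apply hQ
    ext (i | c)
    · rw [hup, hι]
      simp
    · rw [hlow, hι]
      simp [Pi.single_apply]
  simpa using hfin

end Rotation

/-! ### Orthonormal frames along potentials -/

section RotationCoefficients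

variable {n m : ℕ} {U : Set (Eu n)}

/-- Smooth orthonormal vector fields `X_k` on `U ⊆ ℝⁿ` with `∂s_b/∂u_k = H_bk X_k`. -/
structure IsOrthonormalPotential (U : Set (Eu n)) (X : Fin n → Eu n → Eu n)
    (H : Fin m → Fin n → Eu n → ℝ) (s : Fin m → Eu n → Eu n) : Prop where
  smooth_frame : ∀ k, ContDiffOn ℝ ∞ (X k) U
  smooth_coeff : ∀ b k, ContDiffOn ℝ ∞ (H b k) U
  smooth : ∀ b, ContDiffOn ℝ ∞ (s b) U
  inner_eq : ∀ u ∈ U, ∀ k l, inner ℝ (X k u) (X l u) = if k = l then (1 : ℝ) else 0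
  pd_eq : ∀ b k, ∀ u ∈ U, pd k (s b) u = H b k u • X k u
  exists_ne : ∀ u ∈ U, ∃ w : Fin m → ℝ, ∀ k, ∑ b, w b * H b k u ≠ 0

/-- The rotation coefficients of an orthonormal frame. -/
noncomputable def rotationCoeff (X : Fin n → Eu n → Eu n) (i j : Fin n) (u : Eu n) : ℝ :=
  inner ℝ (pd j (X i) u) (X j u)

namespace IsOrthonormalPotential

variable {X : Fin n → Eu n → Eu n} {H : Fin m → Fin n → Eu n → ℝ} {s : Fin m → Eu n → Eu n}
  (h : IsOrthonormalPotential U X H s) (hU : IsOpen U) {u : Eu n} (hu : u ∈ U)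
include h hU hu

omit hU in
lemma expand (v : Eu n) : ∑ k, inner ℝ (X k u) v • X k u = v :=
  sum_inner_smul_eq (orthonormal_iff_ite.2 (h.inner_eq u hu)) (by simp) v

lemma inner_pd_antisymm (j k l : Fin n) :
    inner ℝ (pd j (X k) u) (X l u) = -inner ℝ (pd j (X l) u) (X k u) := by
  have h1 := pd_congr_on hU hu (fun v hv => h.inner_eq v hv k l) j
  rw [pd_inner (diffAt hU (h.smooth_frame k) hu) (diffAt hU (h.smooth_frame l) hu), pd_const,
    real_inner_comm (pd j (X l) u)] at h1
  linarith

lemma inner_pd_self (j k : Fin n) : inner ℝ (pd j (X k) u) (X k u) = (0 : ℝ) := by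
  have := h.inner_pd_antisymm hU hu j k k
  linarith

lemma mixed_pd (b : Fin m) (j k : Fin n) :
    H b k u • pd j (X k) u + pd j (H b k) u • X k u =
      H b j u • pd k (X j) u + pd k (H b j) u • X j u := by
  rw [← pd_smul (diffAt hU (h.smooth_coeff b k) hu) (diffAt hU (h.smooth_frame k) hu),
    ← pd_smul (diffAt hU (h.smooth_coeff b j) hu) (diffAt hU (h.smooth_frame j) hu),
    ← pd_congr_on hU hu (h.pd_eq b k), ← pd_congr_on hU hu (h.pd_eq b j)]
  exact pd_comm hU (h.smooth b) hu j k

/-- For distinct indices `⟨∂_j X_k, X_l⟩` vanishes: divided by the `j`-th coefficient of a suitable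
combination of the potentials, it is symmetric in `j, k` and antisymmetric in `k, l`. -/
lemma inner_pd_distinct {j k l : Fin n} (hjk : j ≠ k) (hkl : k ≠ l) (hlj : l ≠ j) :
    inner ℝ (pd j (X k) u) (X l u) = (0 : ℝ) := by
  obtain ⟨w, hw⟩ := h.exists_ne u hu
  let c : Fin n → ℝ := fun k => ∑ b, w b * H b k u
  let T : Fin n → Fin n → Fin n → ℝ := fun j k l => inner ℝ (pd j (X k) u) (X l u)
  have hT : ∀ j k l, l ≠ j → l ≠ k → c k * T j k l = c j * T k j l := by
    intro j k l hlj hlk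
    simp only [c, Finset.sum_mul]
    refine Finset.sum_congr rfl fun b _ => ?_
    have h1 := congrArg (fun v => inner ℝ v (X l u)) (h.mixed_pd hU hu b j k)
    simp only [inner_add_left, inner_smul_left, h.inner_eq u hu, if_neg hlj.symm,
      if_neg hlk.symm, mul_zero, add_zero, conj_trivial] at h1
    simp only [T]
    rw [mul_assoc, h1, mul_assoc]
  have hS : ∀ j k l, l ≠ j → l ≠ k → T j k l / c j = T k j l / c k := by
    intro j k l hlj hlk
    rw [div_eq_div_iff (hw j) (hw k)]
    linarith [hT j k l hlj hlk]
  have hA : ∀ j k l, T j k l / c j = -(T j l k / c j) := by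
    intro j k l
    rw [← neg_div]
    congr 1
    exact h.inner_pd_antisymm hU hu j k l
  have h1 := hS j k l hlj hkl.symm
  have h2 := hA k j l
  have h3 := hS k l j hjk hlj.symm
  have h4 := hA l k j
  have h5 := hS l j k hkl hjk.symm
  have h6 := hA j l k
  have h7 : T j k l / c j = 0 := by linarith
  exact (div_eq_zero_iff.1 h7).resolve_right (hw j)

lemma pd_frame_ne {i j : Fin n} (hij : i ≠ j) :
    pd j (X i) u = rotationCoeff X i j u • X j u := by
  rw [← h.expand hu (pd j (X i) u), Finset.sum_eq_single j, rotationCoeff, real_inner_comm]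
  · intro l _ hl
    rw [real_inner_comm]
    by_cases hli : l = i
    · rw [hli, h.inner_pd_self hU hu, zero_smul]
    · rw [h.inner_pd_distinct hU hu hij.symm (Ne.symm hli) hl, zero_smul]
  · simp

lemma pd_frame_self (i : Fin n) : pd i (X i) u =
    -∑ k ∈ Finset.univ.filter (fun k => k ≠ i), rotationCoeff X k i u • X k u := by
  rw [← h.expand hu (pd i (X i) u), Finset.sum_filter, ← Finset.sum_neg_distrib]
  refine Finset.sum_congr rfl fun l _ => ?_
  rw [real_inner_comm]
  by_cases hl : l = i
  · rw [hl, h.inner_pd_self hU hu]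
    simp
  · rw [if_pos hl, h.inner_pd_antisymm hU hu, neg_smul, rotationCoeff]

lemma pd_coeff (b : Fin m) {i j : Fin n} (hij : i ≠ j) :
    pd i (H b j) u = rotationCoeff X i j u * H b i u := by
  have h1 := congrArg (fun v => inner ℝ v (X j u)) (h.mixed_pd hU hu b j i)
  simp only [inner_add_left, inner_smul_left, h.inner_eq u hu, if_neg hij, if_true,
    h.inner_pd_self hU hu, mul_zero, add_zero, zero_add, mul_one, conj_trivial] at h1
  rw [← h1, rotationCoeff, mul_comm]

omit hu in
lemma smooth_rotationCoeff (i j : Fin n) : ContDiffOn ℝ ∞ (rotationCoeff X i j) U :=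
  (contDiffOn_pd hU (h.smooth_frame i) j).inner ℝ (h.smooth_frame j)

omit hu in
theorem isLameFamily (b : Fin m) : IsLameFamily U (rotationCoeff X) (H b) where
  smooth := h.smooth_coeff b
  eq _ _ hij _ hu := h.pd_coeff hU hu b hij

theorem isLameFrame : IsLameFrame U (rotationCoeff X) X where
  smooth := h.smooth_frame
  eq_ne _ _ hij _ hu := h.pd_frame_ne hU hu hij
  eq_self i _ hu := h.pd_frame_self hU hu i
  orthonormal := by
    refine ⟨u, hu, ?_⟩
    ext i j
    rw [Matrix.one_apply, ← h.inner_eq u hu i j]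
    simp [Matrix.mul_apply, frameMatrix, PiLp.inner_apply, mul_comm]

omit hu in
/-- The Lamé equations are the integrability conditions of the equations for the frame. -/
theorem isRotation : IsRotation U (rotationCoeff X) where
  smooth i j _ := h.smooth_rotationCoeff hU i j
  eq_triple i j k hij hjk hki u hu := by
    have hd : ∀ i j, DifferentiableAt ℝ (rotationCoeff X i j) u := fun i j =>
      diffAt hU (h.smooth_rotationCoeff hU i j) hu
    have hX : ∀ i, DifferentiableAt ℝ (X i) u := fun i => diffAt hU (h.smooth_frame i) hu
    have h1 := pd_comm hU (h.smooth_frame i) hu k j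
    rw [pd_congr_on hU hu (fun v hv => h.pd_frame_ne hU hv hij),
      pd_congr_on hU hu (fun v hv => h.pd_frame_ne hU hv hki.symm), pd_smul (hd i j) (hX j),
      pd_smul (hd i k) (hX k), h.pd_frame_ne hU hu hjk, h.pd_frame_ne hU hu hjk.symm] at h1
    have h2 := congrArg (fun v => inner ℝ v (X j u)) h1
    simp only [inner_add_left, inner_smul_left, h.inner_eq u hu, if_neg hjk.symm, if_true,
      conj_trivial, mul_zero, mul_one, zero_add, add_zero] at h2
    exact h2
  eq_pair i j hij u hu := by
    have hd : ∀ i j, DifferentiableAt ℝ (rotationCoeff X i j) u := fun i j =>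
      diffAt hU (h.smooth_rotationCoeff hU i j) hu
    have hX : ∀ i, DifferentiableAt ℝ (X i) u := fun i => diffAt hU (h.smooth_frame i) hu
    have h1 := pd_comm hU (h.smooth_frame i) hu i j
    rw [pd_congr_on hU hu (fun v hv => h.pd_frame_ne hU hv hij),
      pd_congr_on hU hu (fun v hv => h.pd_frame_self hU hv i), pd_smul (hd i j) (hX j),
      pd_neg, pd_sum _ fun k _ => (hd k i).fun_smul (hX k)] at h1
    have h2 := congrArg (fun v => inner ℝ v (X j u)) h1
    have h3 : ∀ k, inner ℝ (pd j (fun v => rotationCoeff X k i v • X k v) u) (X j u) =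
        (if k ≠ j then rotationCoeff X k i u * rotationCoeff X k j u else 0) +
          if k = j then pd j (rotationCoeff X j i) u else 0 := by
      intro k
      rw [pd_smul (hd k i) (hX k), inner_add_left, inner_smul_left, inner_smul_left,
        h.inner_eq u hu]
      by_cases hkj : k = j
      · simp [hkj, h.inner_pd_self hU hu]
      · simp [hkj, rotationCoeff]
    simp only [inner_add_left, inner_smul_left, inner_neg_left, sum_inner, h3,
      h.inner_pd_self hU hu, h.inner_eq u hu, Finset.sum_add_distrib, conj_trivial, mul_zero,
      zero_add, if_true, mul_one] at h2
    rw [← Finset.sum_filter, Finset.filter_filter, Finset.sum_ite_eq' _ j,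
      if_pos (by simp [hij.symm])] at h2
    linarith

end IsOrthonormalPotential

end RotationCoefficients

/-! ### Recovering the potentials from a parallel frame -/

section Blocks

variable {ι κ : Type*} [Fintype ι] [Fintype κ] [DecidableEq κ]
  {W₁ : Matrix ι κ ℝ} {W₂ Ω : Matrix κ κ ℝ} {μ : Type*} {Ξ₁ : Matrix ι μ ℝ} {Ξ₂ : Matrix κ μ ℝ}

lemma lower_mul_eq (hΩ : (1 - W₂) * Ω = 1) : W₂ * Ω = Ω - 1 := by
  rw [Matrix.sub_mul, Matrix.one_mul] at hΩ
  rw [← hΩ]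
  abel

/-- `WᵗW = 1` for `W` with blocks `W₁`, `W₂`, multiplied by `Ωᵗ` and `Ω`, where `W₂ Ω = Ω - 1`. -/
lemma add_transpose_eq_of_blocks (hW : W₁ᵀ * W₁ + W₂ᵀ * W₂ = 1) (hΩ : (1 - W₂) * Ω = 1) :
    Ω + Ωᵀ = (W₁ * Ω)ᵀ * (W₁ * Ω) + 1 := by
  have h1 : (W₁ * Ω)ᵀ * (W₁ * Ω) + (W₂ * Ω)ᵀ * (W₂ * Ω) = Ωᵀ * Ω := by
    simp only [Matrix.transpose_mul, Matrix.mul_assoc]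
    rw [← Matrix.mul_add, ← Matrix.mul_assoc W₁ᵀ, ← Matrix.mul_assoc W₂ᵀ, ← Matrix.add_mul, hW,
      Matrix.one_mul]
  rw [eq_sub_of_add_eq h1, lower_mul_eq hΩ]
  simp only [Matrix.transpose_sub, Matrix.transpose_one, Matrix.sub_mul, Matrix.mul_sub,
    Matrix.one_mul, Matrix.mul_one]
  abel

lemma transpose_mul_tangent (hWΞ : W₁ᵀ * Ξ₁ + W₂ᵀ * Ξ₂ = 0) (hΩ : (1 - W₂) * Ω = 1) :
    (W₁ * Ω)ᵀ * Ξ₁ = Ξ₂ - Ωᵀ * Ξ₂ := by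
  have h1 : (W₁ * Ω)ᵀ * Ξ₁ + (W₂ * Ω)ᵀ * Ξ₂ = 0 := by
    rw [Matrix.transpose_mul, Matrix.transpose_mul, Matrix.mul_assoc, Matrix.mul_assoc,
      ← Matrix.mul_add, hWΞ, Matrix.mul_zero]
  rw [lower_mul_eq hΩ, Matrix.transpose_sub, Matrix.transpose_one, Matrix.sub_mul,
    Matrix.one_mul] at h1
  rw [eq_neg_of_add_eq_zero_left h1, neg_sub]

/-- For `𝒢 = W₁ Ω` and `X = Ξ₁ + 𝒢 Ξ₂` one has `𝒢ᵗ X = Ω Ξ₂`. With `d𝒢 = X K Ω` and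
`dΩ = Ω Ξ₂ K Ω` this is the equation `dΩ = 𝒢ᵗ d𝒢`. -/
lemma transpose_mul_frame (hW : W₁ᵀ * W₁ + W₂ᵀ * W₂ = 1) (hWΞ : W₁ᵀ * Ξ₁ + W₂ᵀ * Ξ₂ = 0)
    (hΩ : (1 - W₂) * Ω = 1) : (W₁ * Ω)ᵀ * (Ξ₁ + W₁ * Ω * Ξ₂) = Ω * Ξ₂ := by
  rw [Matrix.mul_add, transpose_mul_tangent hWΞ hΩ, ← Matrix.mul_assoc,
    eq_sub_of_add_eq (add_transpose_eq_of_blocks hW hΩ).symm, Matrix.sub_mul, Matrix.add_mul,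
    Matrix.one_mul]
  abel

lemma frame_transpose_mul_self [DecidableEq μ] (hW : W₁ᵀ * W₁ + W₂ᵀ * W₂ = 1)
    (hWΞ : W₁ᵀ * Ξ₁ + W₂ᵀ * Ξ₂ = 0) (hΞ : Ξ₁ᵀ * Ξ₁ + Ξ₂ᵀ * Ξ₂ = 1) (hΩ : (1 - W₂) * Ω = 1) :
    (Ξ₁ + W₁ * Ω * Ξ₂)ᵀ * (Ξ₁ + W₁ * Ω * Ξ₂) = 1 := by
  have h1 : Ξ₁ᵀ * (W₁ * Ω) = Ξ₂ᵀ - Ξ₂ᵀ * Ω := by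
    have := congrArg Matrix.transpose (transpose_mul_tangent hWΞ hΩ)
    simpa only [Matrix.transpose_mul, Matrix.transpose_transpose, Matrix.transpose_sub] using this
  rw [Matrix.transpose_add, Matrix.transpose_mul _ Ξ₂, Matrix.add_mul, Matrix.mul_assoc Ξ₂ᵀ,
    transpose_mul_frame hW hWΞ hΩ, Matrix.mul_add, ← Matrix.mul_assoc Ξ₁ᵀ, h1,
    eq_sub_of_add_eq hΞ, Matrix.sub_mul, Matrix.mul_assoc]
  abel

end Blocks

section Reconstruction

variable {n m : ℕ} {U : Set (Eu n)} {W : Fin m → Eu n → Amb n m} {ξ : Fin n → Eu n → Amb n m}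
  {C : Fin n → Fin m → Eu n → ℝ}

/-- The matrix `Ω` for which `1 - Ω⁻¹` is the lower block of the matrix with columns `W_b`; it is
meaningful where `1 - lower W` is invertible. -/
noncomputable def frameOmega (W : Fin m → Eu n → Amb n m) (u : Eu n) : Matrix (Fin m) (Fin m) ℝ :=
  (1 - lower W u)⁻¹

/-- The columns `s_b` of the matrix `𝒢` for which `𝒢 Ω⁻¹` is the upper block of the matrix with
columns `W_b`. -/
noncomputable def framePotential (W : Fin m → Eu n → Amb n m) (b : Fin m) (u : Eu n) : Eu n :=
  colVec (upper W u * frameOmega W u) b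

/-- The columns `X_k` of the matrix `Ξ₁ + 𝒢 Ξ₂`, where `Ξ₁` and `Ξ₂` are the blocks of the matrix
of the tangent vectors `ξ_k`. -/
noncomputable def frameTangent (W : Fin m → Eu n → Amb n m) (ξ : Fin n → Eu n → Amb n m)
    (k : Fin n) (u : Eu n) : Eu n :=
  colVec (upper ξ u + upper W u * frameOmega W u * lower ξ u) k

/-- The coefficients `H_bk` with `∂s_b/∂u_k = H_bk X_k`. -/
noncomputable def frameLame (W : Fin m → Eu n → Amb n m) (C : Fin n → Fin m → Eu n → ℝ)
    (b : Fin m) (k : Fin n) (u : Eu n) : ℝ :=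
  ∑ c, C k c u * frameOmega W u c b

/-- The matrix whose only nonzero row is the `k`-th row, with entries `C_kb`. -/
def coeffRow (C : Fin n → Fin m → Eu n → ℝ) (k : Fin n) (u : Eu n) : Matrix (Fin n) (Fin m) ℝ :=
  Matrix.of fun l b => if l = k then C k b u else 0

lemma blocks_apply {κ μ : Type*} (A : κ → Eu n → Amb n m) (B : μ → Eu n → Amb n m) (u : Eu n)
    (i : κ) (j : μ) : ((upper A u)ᵀ * upper B u + (lower A u)ᵀ * lower B u) i j =
      inner ℝ (A i u) (B j u) := by
  simp [Matrix.mul_apply, upper, lower, PiLp.inner_apply, Fintype.sum_sum_type, mul_comm]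

namespace IsParallelFrame

variable (h : IsParallelFrame U W ξ C)
include h

lemma smooth_coeff (hU : IsOpen U) (hξ : ∀ k, ContDiffOn ℝ ∞ (ξ k) U) (k : Fin n) (b : Fin m) :
    ContDiffOn ℝ ∞ (C k b) U := by
  refine ((hξ k).inner ℝ (contDiffOn_pd hU (h.smooth b) k)).congr fun u hu => ?_
  rw [h.pd_eq k b u hu, inner_smul_right, h.inner_tangent hu, if_pos rfl, mul_one]

lemma smooth_upper (i : Fin n) (b : Fin m) : ContDiffOn ℝ ∞ (fun u => upper W u i b) U :=
  contDiffOn_coord_iff.1 (h.smooth b) (Sum.inl i)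

lemma smooth_one_sub_lower (c b : Fin m) :
    ContDiffOn ℝ ∞ (fun u => (1 - lower W u) c b) U :=
  contDiffOn_const.sub (contDiffOn_coord_iff.1 (h.smooth b) (Sum.inr c))

section

variable {u : Eu n} (hu : u ∈ U)
include hu

lemma blocks_normal : (upper W u)ᵀ * upper W u + (lower W u)ᵀ * lower W u = 1 := by
  ext a b
  rw [blocks_apply, h.inner_normal hu, Matrix.one_apply]

lemma blocks_tangent : (upper ξ u)ᵀ * upper ξ u + (lower ξ u)ᵀ * lower ξ u = 1 := by
  ext a b
  rw [blocks_apply, h.inner_tangent hu, Matrix.one_apply]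

lemma blocks_normal_tangent : (upper W u)ᵀ * upper ξ u + (lower W u)ᵀ * lower ξ u = 0 := by
  ext a b
  rw [blocks_apply, real_inner_comm, h.inner_tangent_normal hu, Matrix.zero_apply]

end

variable (hU : IsOpen U) (hdet : ∀ u ∈ U, IsUnit (1 - lower W u))
include hdet

omit h in
lemma one_sub_lower_mul_frameOmega {u : Eu n} (hu : u ∈ U) :
    (1 - lower W u) * frameOmega W u = 1 :=
  Matrix.mul_nonsing_inv _ ((Matrix.isUnit_iff_isUnit_det _).1 (hdet u hu))

omit h in
lemma frameOmega_mul_one_sub_lower {u : Eu n} (hu : u ∈ U) :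
    frameOmega W u * (1 - lower W u) = 1 :=
  Matrix.nonsing_inv_mul _ ((Matrix.isUnit_iff_isUnit_det _).1 (hdet u hu))

lemma smooth_frameOmega (a b : Fin m) : ContDiffOn ℝ ∞ (fun u => frameOmega W u a b) U :=
  contDiffOn_matrix_inv h.smooth_one_sub_lower hdet a b

lemma smooth_upper_mul_frameOmega (i : Fin n) (b : Fin m) :
    ContDiffOn ℝ ∞ (fun u => (upper W u * frameOmega W u) i b) U :=
  contDiffOn_matrix_mul (A := upper W) (B := frameOmega W) h.smooth_upper
    (h.smooth_frameOmega hdet) i b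

lemma smooth_framePotential (b : Fin m) : ContDiffOn ℝ ∞ (framePotential W b) U :=
  contDiffOn_coord_iff.2 fun i => h.smooth_upper_mul_frameOmega hdet i b

lemma smooth_frameTangent (hξ : ∀ k, ContDiffOn ℝ ∞ (ξ k) U) (k : Fin n) :
    ContDiffOn ℝ ∞ (frameTangent W ξ k) U :=
  contDiffOn_coord_iff.2 fun i => (contDiffOn_coord_iff.1 (hξ k) (Sum.inl i)).add
    (contDiffOn_matrix_mul (A := fun u => upper W u * frameOmega W u) (B := lower ξ)
      (h.smooth_upper_mul_frameOmega hdet)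
      (fun c k => contDiffOn_coord_iff.1 (hξ k) (Sum.inr c)) i k)

omit h hdet in
lemma coeffRow_mul_apply (k l : Fin n) (b : Fin m) (u : Eu n) :
    (coeffRow C k u * frameOmega W u) l b = if l = k then frameLame W C b k u else 0 := by
  by_cases hl : l = k <;> simp [Matrix.mul_apply, coeffRow, frameLame, hl]

include hU

omit hdet in
lemma pdMat_upper {u : Eu n} (hu : u ∈ U) (k : Fin n) :
    pdMat k (upper W) u = upper ξ u * coeffRow C k u := by
  ext i b
  change pd k (fun v => W b v (Sum.inl i)) u = _
  rw [pd_coord (diffAt hU (h.smooth b) hu), h.pd_eq k b u hu]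
  simp [Matrix.mul_apply, coeffRow, upper, mul_comm]

omit hdet in
lemma pdMat_one_sub_lower {u : Eu n} (hu : u ∈ U) (k : Fin n) :
    pdMat k (fun v => 1 - lower W v) u = -(lower ξ u * coeffRow C k u) := by
  rw [pdMat_sub (A := fun _ => 1) (B := lower W) (fun _ _ => differentiableAt_const _)
    (fun c b => diffAt hU (contDiffOn_coord_iff.1 (h.smooth b) (Sum.inr c)) hu), pdMat_const,
    zero_sub]
  congr 1
  ext c b
  change pd k (fun v => W b v (Sum.inr c)) u = _
  rw [pd_coord (diffAt hU (h.smooth b) hu), h.pd_eq k b u hu]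
  simp [Matrix.mul_apply, coeffRow, lower, mul_comm]

lemma pdMat_frameOmega {u : Eu n} (hu : u ∈ U) (k : Fin n) :
    pdMat k (frameOmega W) u =
      frameOmega W u * lower ξ u * (coeffRow C k u * frameOmega W u) := by
  have h1 := pdMat_inv hU h.smooth_one_sub_lower hdet hu k
  rw [h.pdMat_one_sub_lower hU hu] at h1
  refine h1.trans ?_
  simp only [Matrix.mul_neg, Matrix.neg_mul, neg_neg, Matrix.mul_assoc, frameOmega]

lemma pdMat_matG {u : Eu n} (hu : u ∈ U) (k : Fin n) :
    pdMat k (matG (framePotential W)) u =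
      (upper ξ u + upper W u * frameOmega W u * lower ξ u) *
        (coeffRow C k u * frameOmega W u) := by
  change pdMat k (fun v => upper W v * frameOmega W v) u = _
  rw [pdMat_mul (fun i a => diffAt hU (h.smooth_upper i a) hu)
    (fun a b => diffAt hU (h.smooth_frameOmega hdet a b) hu), h.pdMat_upper hU hu,
    h.pdMat_frameOmega hU hdet hu, Matrix.add_mul]
  simp only [Matrix.mul_assoc]

theorem isOrthonormalPotential (hξ : ∀ k, ContDiffOn ℝ ∞ (ξ k) U) {a : Fin m}
    (hC : ∀ k, ∀ u ∈ U, C k a u ≠ 0) :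
    IsOrthonormalPotential U (frameTangent W ξ) (frameLame W C) (framePotential W) where
  smooth_frame := h.smooth_frameTangent hdet hξ
  smooth_coeff b k := ContDiffOn.sum fun c _ =>
    (h.smooth_coeff hU hξ k c).mul (h.smooth_frameOmega hdet c b)
  smooth := h.smooth_framePotential hdet
  inner_eq u hu k l := by
    rw [frameTangent, frameTangent, inner_colVec,
      frame_transpose_mul_self (h.blocks_normal hu) (h.blocks_normal_tangent hu)
        (h.blocks_tangent hu) (one_sub_lower_mul_frameOmega hdet hu), Matrix.one_apply]
  pd_eq b k u hu := by
    ext i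
    rw [← pd_coord (diffAt hU (h.smooth_framePotential hdet b) hu)]
    change pdMat k (matG (framePotential W)) u i b = _
    rw [h.pdMat_matG hU hdet hu, Matrix.mul_apply]
    simp only [coeffRow_mul_apply]
    simp [frameTangent, colVec, mul_comm]
  exists_ne u hu := by
    -- the combination with weights `Ω⁻¹ e_a` has the coefficients `C_ka`
    refine ⟨fun b => (1 - lower W u) b a, fun k => ?_⟩
    let K : Matrix (Fin n) (Fin m) ℝ := Matrix.of fun k c => C k c u
    have h1 : ∑ b, (1 - lower W u) b a * frameLame W C b k u =
        (K * (frameOmega W u * (1 - lower W u)) : Matrix (Fin n) (Fin m) ℝ) k a := by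
      rw [← Matrix.mul_assoc, Matrix.mul_apply]
      exact Finset.sum_congr rfl fun b _ => mul_comm _ _
    rw [h1, frameOmega_mul_one_sub_lower hdet hu, Matrix.mul_one]
    exact hC k u hu

theorem isOmega : IsOmega U (framePotential W) (frameOmega W) where
  smooth := h.smooth_frameOmega hdet
  deriv_eq k u hu := by
    rw [h.pdMat_matG hU hdet hu, h.pdMat_frameOmega hU hdet hu, ← Matrix.mul_assoc _ (_ + _)]
    congr 1
    exact (transpose_mul_frame (h.blocks_normal hu) (h.blocks_normal_tangent hu)
      (one_sub_lower_mul_frameOmega hdet hu)).symm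
  symm_eq u hu := add_transpose_eq_of_blocks (h.blocks_normal hu)
    (one_sub_lower_mul_frameOmega hdet hu)

omit h hU in
lemma colW_eq {u : Eu n} (hu : u ∈ U) (a : Fin m) :
    colW (framePotential W) (frameOmega W) a u = W a u := by
  have hinv : (frameOmega W u)⁻¹ = 1 - lower W u :=
    Matrix.inv_eq_right_inv (frameOmega_mul_one_sub_lower hdet hu)
  have hup : matG (framePotential W) u * (1 - lower W u) = upper W u := by
    change upper W u * frameOmega W u * _ = _
    rw [Matrix.mul_assoc, frameOmega_mul_one_sub_lower hdet hu, Matrix.mul_one]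
  ext (i | c)
  · simp [colW, matW, hinv, hup, upper]
  · simp [colW, matW, hinv, lower]

omit hdet in
lemma isOpen_isUnit_one_sub_lower : IsOpen {u ∈ U | IsUnit (1 - lower W u)} := by
  have h1 : {u ∈ U | IsUnit (1 - lower W u)} =
      U ∩ (fun u => (1 - lower W u).det) ⁻¹' {x | x ≠ 0} := by
    ext u
    rw [Set.mem_ofPred_eq, Matrix.isUnit_iff_isUnit_det, isUnit_iff_ne_zero]
    rfl
  rw [h1]
  exact (contDiffOn_det h.smooth_one_sub_lower).continuousOn.isOpen_inter_preimage hU isOpen_ne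

end IsParallelFrame

end Reconstruction

/-! ### The two directions -/

section Main

variable {n m : ℕ} {U : Set (Eu n)}

/-- Near a point where `W_a` differs from `e_{n+a}`, a parallel frame comes from the direct
construction. -/
theorem IsParallelFrame.exists_data {W : Fin m → Eu n → Amb n m} {ξ : Fin n → Eu n → Amb n m}
    {C : Fin n → Fin m → Eu n → ℝ} (h : IsParallelFrame U W ξ C) (hU : IsOpen U)
    (hξ : ∀ k, ContDiffOn ℝ ∞ (ξ k) U) {a : Fin m} (hC : ∀ k, ∀ u ∈ U, C k a u ≠ 0)
    {u₀ : Eu n} (hu₀ : u₀ ∈ U) (ha : W a u₀ ≠ EuclideanSpace.single (Sum.inr a) 1) :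
    ∃ (U' : Set (Eu n)) (β : Fin n → Fin n → Eu n → ℝ) (H : Fin m → Fin n → Eu n → ℝ)
      (X : Fin n → Eu n → Eu n) (s : Fin m → Eu n → Eu n)
      (Ω : Eu n → Matrix (Fin m) (Fin m) ℝ),
      IsOpen U' ∧ SimplyConnectedSpace U' ∧ u₀ ∈ U' ∧ U' ⊆ U ∧
      IsRotation U' β ∧ (∀ b, IsLameFamily U' β (H b)) ∧ IsLameFrame U' β X ∧
      (∀ b, IsPotential U' X (H b) (s b)) ∧ IsOmega U' s Ω ∧
      ∀ u ∈ U', W a u = colW s Ω a u := by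
  obtain ⟨W', C', h', hW', hC', hdet⟩ := h.exists_isUnit_one_sub_lower hU hu₀ ha
  obtain ⟨r, hr, hrU⟩ := Metric.isOpen_iff.1 (h'.isOpen_isUnit_one_sub_lower hU) u₀ ⟨hu₀, hdet⟩
  have hB : Metric.ball u₀ r ⊆ U := fun u hu => (hrU hu).1
  have hBo : IsOpen (Metric.ball u₀ r) := Metric.isOpen_ball
  have hu₀B : u₀ ∈ Metric.ball u₀ r := Metric.mem_ball_self hr
  have hBdet : ∀ u ∈ Metric.ball u₀ r, IsUnit (1 - lower W' u) := fun u hu => (hrU hu).2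
  have hp : IsParallelFrame (Metric.ball u₀ r) W' ξ C' :=
    ⟨fun b => (h'.smooth b).mono hB, fun u hu => h'.orthonormal u (hB hu),
      fun k b u hu => h'.pd_eq k b u (hB hu)⟩
  have hs := hp.isOrthonormalPotential hBo hBdet (fun k => (hξ k).mono hB) (a := a)
    fun k u hu => by rw [hC']; exact hC k u (hB hu)
  have : ContractibleSpace (Metric.ball u₀ r) :=
    (convex_ball u₀ r).contractibleSpace ⟨u₀, hu₀B⟩
  exact ⟨Metric.ball u₀ r, _, frameLame W' C', frameTangent W' ξ, framePotential W',
    frameOmega W', hBo, inferInstance, hu₀B, hB, hs.isRotation hBo, hs.isLameFamily hBo,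
    hs.isLameFrame hBo hu₀B, fun b => isPotential_of_pd_eq hBo (hs.smooth b) (hs.pd_eq b),
    hp.isOmega hBo hBdet, fun u hu => by rw [IsParallelFrame.colW_eq hBdet hu, hW']⟩

/-- An immersion of a manifold into the unit sphere, read in a chart with principal coordinates. -/
lemma isPrincipalImmersion_comp_symm {M : Type*} [TopologicalSpace M] [ChartedSpace (Eu n) M]
    [IsManifold (𝓡 n) ∞ M] {f : M → Amb n m} (hf : ContMDiff (𝓡 n) 𝓘(ℝ, Amb n m) ∞ f)
    (hinj : ∀ p, Function.Injective (mfderiv (𝓡 n) 𝓘(ℝ, Amb n m) f p))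
    (hsph : ∀ p, f p ∈ Metric.sphere (0 : Amb n m) 1) {e : OpenPartialHomeomorph M (Eu n)}
    (he : e ∈ IsManifold.maximalAtlas (𝓡 n) ∞ M)
    (hpr : HasPrincipalCoordinates (f ∘ e.symm) e.target) :
    IsPrincipalImmersion (f ∘ e.symm) e.target where
  isOpen := e.open_target
  smooth := by
    rw [← contMDiffOn_iff_contDiffOn]
    exact hf.comp_contMDiffOn (contMDiffOn_symm_of_mem_maximalAtlas he)
  mem_sphere u _ := hsph _
  injective u hu := by
    have hd : e.MDifferentiable (𝓡 n) (𝓡 n) :=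
      ⟨(contMDiffOn_of_mem_maximalAtlas he).mdifferentiableOn (by simp),
        (contMDiffOn_symm_of_mem_maximalAtlas he).mdifferentiableOn (by simp)⟩
    rw [← mfderiv_eq_fderiv, mfderiv_comp u ((hf _).mdifferentiableAt (by simp))
      (hd.mdifferentiableAt_symm hu)]
    exact (hinj _).comp (hd.symm.mfderiv_injective hu)
  principal := hpr

end Main

end Ferapontov

theorem theorem20 (n m : ℕ) :
    -- the direct construction
    (∀ (U : Set (Eu n)) (β : Fin n → Fin n → Eu n → ℝ),
      IsOpen U → SimplyConnectedSpace U → IsRotation U β →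
      -- the integrability conditions of the two linear systems hold
      LameIntegrable U β ∧ FrameIntegrable U β ∧
      ∀ (H : Fin m → Fin n → Eu n → ℝ) (X : Fin n → Eu n → Eu n),
        (∀ a, IsLameFamily U β (H a)) → IsLameFrame U β X →
        -- existence of `s^1, …, s^m` and, for any choice of them, of `Ω`
        (∃ s : Fin m → Eu n → Eu n, ∀ a, IsPotential U X (H a) (s a)) ∧
        ∀ s : Fin m → Eu n → Eu n, (∀ a, IsPotential U X (H a) (s a)) →
          (∃ Ω : Eu n → Matrix (Fin m) (Fin m) ℝ, IsOmega U s Ω) ∧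
          ∀ Ω : Eu n → Matrix (Fin m) (Fin m) ℝ, IsOmega U s Ω →
            (∀ u ∈ U, IsUnit (Ω u) ∧ (matW s Ω u)ᵀ * matW s Ω u = 1) ∧
            ∀ a : Fin m,
              ContDiffOn ℝ ∞ (colW s Ω a) U ∧
              IsSphericalImmersion (colW s Ω a) (regularSet (colW s Ω a) U) ∧
              HasFlatNormalBundle (colW s Ω a) (regularSet (colW s Ω a) U) ∧
              HasPrincipalCoordinates (colW s Ω a) (regularSet (colW s Ω a) U)) ∧
    -- the converse, around each point `p` and for each principal chart `e` at `p`
    (∀ (M : Type*) [TopologicalSpace M] [ChartedSpace (Eu n) M] [IsManifold (𝓡 n) ∞ M]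
      (f : M → Amb n m),
      ContMDiff (𝓡 n) 𝓘(ℝ, Amb n m) ∞ f →
      (∀ p, Function.Injective (mfderiv (𝓡 n) 𝓘(ℝ, Amb n m) f p)) →
      (∀ p, f p ∈ Metric.sphere (0 : Amb n m) 1) →
      (∀ e ∈ IsManifold.maximalAtlas (𝓡 n) ∞ M, HasFlatNormalBundle (f ∘ e.symm) e.target) →
      ∀ p : M, ∀ e ∈ IsManifold.maximalAtlas (𝓡 n) ∞ M, p ∈ e.source →
        HasPrincipalCoordinates (f ∘ e.symm) e.target →
        ∀ a : Fin m,
          ∃ (U : Set (Eu n)) (β : Fin n → Fin n → Eu n → ℝ) (H : Fin m → Fin n → Eu n → ℝ)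
            (X : Fin n → Eu n → Eu n) (s : Fin m → Eu n → Eu n)
            (Ω : Eu n → Matrix (Fin m) (Fin m) ℝ) (T : Amb n m ≃ₗᵢ[ℝ] Amb n m),
            IsOpen U ∧ SimplyConnectedSpace U ∧ e p ∈ U ∧ U ⊆ e.target ∧
            IsRotation U β ∧ (∀ b, IsLameFamily U β (H b)) ∧ IsLameFrame U β X ∧
            (∀ b, IsPotential U X (H b) (s b)) ∧ IsOmega U s Ω ∧
            -- no rigid motion is needed unless `f p` is the basis vector `e_{n+a}`
            (f p ≠ EuclideanSpace.single (Sum.inr a) 1 → T = LinearIsometryEquiv.refl ℝ _) ∧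
            ∀ u ∈ U, T (f (e.symm u)) = colW s Ω a u) := by
  refine ⟨fun U β hU hsc hβ => ⟨hβ.lameIntegrable, hβ.frameIntegrable, fun H X hH hX =>
    ⟨?_, fun s hs => ⟨exists_isOmega hU hsc hX hs, fun Ω hΩ => ⟨fun u hu => ?_, fun a => ?_⟩⟩⟩⟩,
    fun M _ _ _ f hf hinj hsph hflat p e he hp hpr a => ?_⟩
  · choose s hs using fun a => exists_isPotential hU hsc (hH a) hX
    exact ⟨s, hs⟩
  · have hunit := isUnit_of_add_transpose (hΩ.symm_eq u hu)
    exact ⟨hunit, fromRows_transpose_mul_self (hΩ.symm_eq u hu)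
      (Matrix.mul_nonsing_inv _ ((Matrix.isUnit_iff_isUnit_det _).1 hunit))⟩
  · have hc : IsPreconnected U := isPreconnected_iff_preconnectedSpace.2 inferInstance
    have hW := isParallelFrame_colW hU hc hX hs hΩ
    exact ⟨hW.smooth a, hW.isSphericalImmersion hU, hW.hasFlatNormalBundle hU,
      hW.hasPrincipalCoordinates hU⟩
  · have himm := isPrincipalImmersion_comp_symm hf hinj hsph he hpr
    have hfp : (f ∘ e.symm) (e p) = f p := congrArg f (e.left_inv hp)
    obtain ⟨r, hr, hrV, W, C, hW, hWa, hC⟩ :=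
      himm.exists_isParallelFrame (hflat e he) a (e.map_source hp)
    have hξ : ∀ k, ContDiffOn ℝ ∞ (unitTangent (f ∘ e.symm) k) (Metric.ball (e p) r) :=
      fun k => (himm.smooth_unitTangent k).mono hrV
    by_cases hpa : f p = EuclideanSpace.single (Sum.inr a) 1
    · -- after the antipodal map the point is different from the basis vector
      obtain ⟨U, β, H, X, s, Ω, hU, hsc, hpU, hUr, hβ, hH, hX, hs, hΩ, heq⟩ :=
        hW.neg.exists_data Metric.isOpen_ball hξ (a := a)
          (fun k u hu => neg_ne_zero.2 (hC k u hu)) (Metric.mem_ball_self hr) (by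
            rw [hWa, hfp, hpa]
            intro h
            have h1 := congrArg (fun v : Amb n m => v (Sum.inr a)) h
            norm_num at h1)
      refine ⟨U, β, H, X, s, Ω, LinearIsometryEquiv.neg ℝ, hU, hsc, hpU, hUr.trans hrV, hβ, hH, hX,
        hs, hΩ, fun h => absurd hpa h, fun u hu => ?_⟩
      rw [← heq u hu, hWa]
      rfl
    · obtain ⟨U, β, H, X, s, Ω, hU, hsc, hpU, hUr, hβ, hH, hX, hs, hΩ, heq⟩ :=
        hW.exists_data Metric.isOpen_ball hξ hC (Metric.mem_ball_self hr)
          (by rwa [hWa, hfp])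
      refine ⟨U, β, H, X, s, Ω, LinearIsometryEquiv.refl ℝ _, hU, hsc, hpU, hUr.trans hrV, hβ, hH,
        hX, hs, hΩ, fun _ => rfl, fun u hu => ?_⟩
      rw [← heq u hu, hWa]
      rfl
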